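/- Let $\mathcal X$ be a real Hilbert space with identity operator $I$. For self-adjoint bounded linear operators $A,B$ on $\mathcal X$ write $A\succeq B$ if $\langle Ax,x\rangle\ge\langle Bx,x\rangle$ for all $x\in\mathcal X$, and for self-adjoint $V\succeq 0$ put $\|x\|_V=\sqrt{\langle Vx,x\rangle}$; an operator that occurs in such an inequality is understood to be bounded, linear and self-adjoint. Let $\Gamma_0(\mathcal X)$ be the set of proper lower semicontinuous convex functions from $\mathcal X$ to $]-\infty,+\infty]$, and for $g\in\Gamma_0(\mathcal X)$, $\tau>0$ and $V\succeq\alpha I$ with $\alpha>0$ let $\operatorname{prox}^{V}_{\tau g}(x)$ be the minimizer of $u\mapsto g(u)+\frac1{2\tau}\|x-u\|_V^2$. Let $g\in\Gamma_0(\mathcal X)$, let $\beta\in\,]0,+\infty[$, and let $f:\mathcal X\to\mathbb R$ be convex and differentiable with a $1/\beta$-Lipschitz gradient. Let $\mu_U,\nu_U\in\,]0,+\infty[$ and let $(U^k)_{k\in\mathbb N}$ be operators on $\mathcal X$ with $\mu_U I\succeq U^k\succeq\nu_U I$ for all $k$. Let $\varepsilon\in\,]0,\min\{1,2\beta/(\mu_U+1)\}[$,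 let $\mu_\Lambda,\nu_\Lambda\in[\varepsilon,1]$, and let $(\Lambda^k)_{k\in\mathbb N}$ be operators on $\mathcal X$ with $\mu_\Lambda I\succeq\Lambda^k\succeq\nu_\Lambda I$ and $\Lambda^kU^k=U^k\Lambda^k$ for all $k$. Let $(\eta^k)_{k\in\mathbb N}$ be a summable sequence in $[0,+\infty[$ such that $(1+\eta^k)\Lambda^{k+1}U^{k+1}\succeq\Lambda^kU^k$ for all $k$. Let $(\gamma^k)_{k\in\mathbb N}$ be a sequence in $[\varepsilon,(2\beta-\varepsilon)/\mu_U]$, and let $(a^k)_{k\in\mathbb N}$, $(b^k)_{k\in\mathbb N}$ be sequences in $\mathcal X$ with $\sum_k\|a^k\|<+\infty$ and $\sum_k\|b^k\|<+\infty$. Suppose that $Z=\operatorname{Argmin}(f+g)\neq\emptyset$. Let $x^0\in\mathcal X$ and, for all $k\in\mathbb N$, $$y^k=x^k-\gamma^kU^k\big(\nabla f(x^k)+b^k\big),\qquad x^{k+1}=x^k+\Lambda^k\Big(\operatorname{prox}^{(U^k)^{-1}}_{\gamma^kg}(y^k)+a^k-x^k\Big).$$ Then the following hold. 1) $(x^k)$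 is quasi-Fejér monotone with respect to $Z$ relative to $(V^k)$, where $V^k=(\Lambda^kU^k)^{-1}$. That is, $Z$ is nonempty, closed and convex; there is $\alpha>0$ such that $V^k$ is self-adjoint and $V^k\succeq\alpha I$ for all $k$; $\sup_k\|V^k\|<+\infty$; and there are summable sequences $(\bar\eta^k)$ and $(\epsilon^k)$ in $[0,+\infty[$ such that, for all $k$, $(1+\bar\eta^k)V^k\succeq V^{k+1}$ and $$\|x^{k+1}-z\|_{V^{k+1}}\le(1+\bar\eta^k)\|x^k-z\|_{V^k}+\epsilon^k\qquad\text{for all } z\in Z.$$ 2) $(x^k)$ converges weakly to a point of $Z$. -/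

import Mathlib

open Filter Topology Set
open scoped InnerProductSpace

noncomputable section

namespace OperatorAveraged

variable {X : Type*} [NormedAddCommGroup X] [InnerProductSpace ℝ X]

/-- The class `Γ₀(X)` of proper lower semicontinuous convex functions from `X` to `]-∞, +∞]`;
lower semicontinuity and convexity are closedness and convexity of the epigraph. -/
structure IsGammaZero (g : X → EReal) : Prop where
  ne_bot : ∀ x, g x ≠ ⊥
  proper : ∃ x, g x ≠ ⊤
  lsc : IsClosed {p : X × ℝ | g p.1 ≤ (p.2 : EReal)}
  convex : Convex ℝ {p : X × ℝ | g p.1 ≤ (p.2 : EReal)}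

/-- The set of (global) minimizers of an extended-real-valued function. -/
def Argmin (h : X → EReal) : Set X := {x | ∀ y, h x ≤ h y}

/-- The (semi-)norm `‖x‖_V = √⟨V x, x⟩` induced by a positive semidefinite operator `V`. -/
def metricNorm (V : X →L[ℝ] X) (x : X) : ℝ := Real.sqrt ⟪V x, x⟫_ℝ

/-- The objective `u ↦ g u + (1 / (2 τ)) ‖x - u‖_V ^ 2` whose minimizer is the proximal point. -/
def proxObjective (V : X →L[ℝ] X) (τ : ℝ) (g : X → EReal) (x u : X) : EReal :=
  g u + ((1 / (2 * τ) * metricNorm V (x - u) ^ 2 : ℝ) : EReal)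

/-- The proximal operator `prox_{τ g}^V x`, the point `u` at which the function
`u ↦ g u + (1 / (2 τ)) ‖x - u‖_V ^ 2` attains its minimum. The value is arbitrary if there is
no such point; there is exactly one when `g ∈ Γ₀(X)`, `τ > 0` and `V ≽ α I` with `α > 0`. -/
def prox (V : X →L[ℝ] X) (τ : ℝ) (g : X → EReal) (x : X) : X :=
  Classical.epsilon fun p => p ∈ Argmin (proxObjective V τ g x)

/-- Weak convergence of a sequence in a Hilbert space. -/
def WeaklyConvergesTo (x : ℕ → X) (z : X) : Prop :=
  ∀ u : X, Tendsto (fun k => ⟪x k, u⟫_ℝ) atTop (𝓝 ⟪z, u⟫_ℝ)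

variable [CompleteSpace X]

/-- Quasi-Fejér monotonicity of `x` with respect to the nonempty closed convex set `S` relative
to the sequence of metrics `V`. The order on operators is the Loewner order (which includes
self-adjointness of the difference), so `α • 1 ≤ V k` says that `V k` is self-adjoint and
`V k ≽ α I`. -/
def QuasiFejerMonotone (S : Set X) (V : ℕ → X →L[ℝ] X) (x : ℕ → X) : Prop :=
  S.Nonempty ∧ IsClosed S ∧ Convex ℝ S ∧
  (∃ α : ℝ, 0 < α ∧ ∀ k, α • (1 : X →L[ℝ] X) ≤ V k) ∧
  BddAbove (range fun k => ‖V k‖) ∧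
  ∃ η ε : ℕ → ℝ,
    (∀ k, 0 ≤ η k) ∧ Summable η ∧ (∀ k, 0 ≤ ε k) ∧ Summable ε ∧
    (∀ k, V (k + 1) ≤ (1 + η k) • V k) ∧
    ∀ z ∈ S, ∀ k,
      metricNorm (V (k + 1)) (x (k + 1) - z) ≤ (1 + η k) * metricNorm (V k) (x k - z) + ε k

/-- `x` is generated by the operator-averaged variable-metric forward–backward iteration
`y k = x k - γ k U k (∇f (x k) + b k)`,
`x (k + 1) = x k + Λ k (prox_{γ k g}^{(U k)⁻¹} (y k) + a k - x k)`. -/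
def IsGenerated (f : X → ℝ) (g : X → EReal) (U Λ : ℕ → X →L[ℝ] X) (γ : ℕ → ℝ)
    (a b : ℕ → X) (x : ℕ → X) : Prop :=
  ∃ y : ℕ → X, ∀ k,
    y k = x k - γ k • U k (gradient f (x k) + b k) ∧
    x (k + 1) = x k + Λ k (prox (Ring.inverse (U k)) (γ k) g (y k) + a k - x k)

end OperatorAveraged

end

/-! Write `q` for the exact forward–backward point of `x`, and `V = (ΛU)⁻¹`. Optimality of the prox
puts `γ⁻¹U⁻¹(x - q) - ∇f x` in the subdifferential of `g` at `q`, while `-∇f z` lies in it at a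
solution `z`. Monotonicity and the cocoercivity of the gradient (Baillon–Haddad) make the exact step
decrease `‖· - z‖²` in the metric `U⁻¹`, with a surplus controlling `‖x - q‖²` and `‖∇f x - ∇f z‖²`
(`forward_backward_decrease`). Since `VΛ = U⁻¹` and products of commuting positive operators are
positive (`inner_mul_nonneg`), the decrease passes to the averaged step in the metric `V`
(`inner_relaxed_le`). The errors add a summable term and the change of metric a factor `1 + η k`:
this is the quasi-Fejér property.

Hence the distances to each solution converge and the surplus tends to zero. At a weak cluster point
`z`, cocoercivity turns this into strong convergence of the gradients to `∇f z`, and weak–strong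
closedness of the graph of the subdifferential (`IsSubgradient.of_weak_tendsto`) shows that `z` is a
minimizer. The metrics converge strongly, so Opial's argument leaves a single cluster point
(`exists_weaklyConvergesTo`). Cluster points are taken along ultrafilters, which replaces the
extraction of subsequences. -/

namespace OperatorAveraged

/-! ### Loewner order, commuting positive operators, metric norms and inverses. -/

section Operators

variable {X : Type*} [NormedAddCommGroup X] [InnerProductSpace ℝ X]

theorem isPositive_of_inner {T : X →L[ℝ] X} (hs : ∀ x y, ⟪T x, y⟫_ℝ = ⟪x, T y⟫_ℝ)
    (hp : ∀ x, 0 ≤ ⟪T x, x⟫_ℝ) : T.IsPositive :=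
  (ContinuousLinearMap.isPositive_iff T).2 ⟨hs, hp⟩

theorem inner_le_of_le {A B : X →L[ℝ] X} (h : A ≤ B) (x : X) : ⟪A x, x⟫_ℝ ≤ ⟪B x, x⟫_ℝ := by
  have := ((ContinuousLinearMap.le_def A B).1 h).inner_nonneg_left x
  simpa [inner_sub_left] using this

theorem le_of_inner_le {A B : X →L[ℝ] X} (hA : ∀ x y, ⟪A x, y⟫_ℝ = ⟪x, A y⟫_ℝ)
    (hB : ∀ x y, ⟪B x, y⟫_ℝ = ⟪x, B y⟫_ℝ) (h : ∀ x, ⟪A x, x⟫_ℝ ≤ ⟪B x, x⟫_ℝ) : A ≤ B := by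
  rw [ContinuousLinearMap.le_def]
  refine isPositive_of_inner (fun x y => ?_) fun x => ?_
  · simp [inner_sub_left, inner_sub_right, hA, hB]
  · simpa [inner_sub_left] using h x

theorem inner_symm_of_smul_one_le {ν : ℝ} {A : X →L[ℝ] X} (h : ν • (1 : X →L[ℝ] X) ≤ A) (x y : X) :
    ⟪A x, y⟫_ℝ = ⟪x, A y⟫_ℝ := by
  have := ((ContinuousLinearMap.le_def _ A).1 h).inner_left_eq_inner_right x y
  simpa [inner_sub_left, inner_sub_right, real_inner_smul_left, real_inner_smul_right] using this

theorem mul_norm_sq_le_of_smul_one_le {ν : ℝ} {A : X →L[ℝ] X} (h : ν • (1 : X →L[ℝ] X) ≤ A)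
    (x : X) : ν * ‖x‖ ^ 2 ≤ ⟪A x, x⟫_ℝ := by
  simpa [real_inner_smul_left] using inner_le_of_le h x

theorem inner_le_of_le_smul_one {μ : ℝ} {A : X →L[ℝ] X} (h : A ≤ μ • (1 : X →L[ℝ] X))
    (x : X) : ⟪A x, x⟫_ℝ ≤ μ * ‖x‖ ^ 2 := by
  simpa [real_inner_smul_left] using inner_le_of_le h x

/-- A positive operator bounded above by `K` satisfies `‖D w‖² ≤ K ⟨D w, w⟩`. -/
theorem norm_sq_apply_le {D : X →L[ℝ] X} (hD : D.IsPositive) {K : ℝ} (hK : 0 < K)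
    (h : ∀ x, ⟪D x, x⟫_ℝ ≤ K * ‖x‖ ^ 2) (w : X) : ‖D w‖ ^ 2 ≤ K * ⟪D w, w⟫_ℝ := by
  -- The test vector `w - K⁻¹ D w` is one gradient step for the quadratic form of `D`, with the step
  -- length that its upper bound `K` allows.
  have h1 := hD.inner_nonneg_left (w - K⁻¹ • D w)
  have h2 := h (D w)
  have h3 : ⟪D (w - K⁻¹ • D w), w - K⁻¹ • D w⟫_ℝ
      = ⟪D w, w⟫_ℝ - 2 * K⁻¹ * ‖D w‖ ^ 2 + K⁻¹ * (K⁻¹ * ⟪D (D w), D w⟫_ℝ) := by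
    have h4 : ⟪D (D w), w⟫_ℝ = ‖D w‖ ^ 2 := by
      rw [hD.inner_left_eq_inner_right, real_inner_self_eq_norm_sq]
    simp only [map_sub, map_smul, inner_sub_left, inner_sub_right, real_inner_smul_left,
      real_inner_smul_right, h4, real_inner_self_eq_norm_sq]
    ring
  rw [h3] at h1
  have h5 : K⁻¹ * ⟪D (D w), D w⟫_ℝ ≤ ‖D w‖ ^ 2 := by
    rw [inv_mul_le_iff₀ hK]; exact h2
  have h6 : K⁻¹ * (K⁻¹ * ⟪D (D w), D w⟫_ℝ) ≤ K⁻¹ * ‖D w‖ ^ 2 := by gcongr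
  have h7 : K⁻¹ * ‖D w‖ ^ 2 ≤ ⟪D w, w⟫_ℝ := by linarith
  rwa [inv_mul_le_iff₀ hK] at h7

theorem norm_apply_le_of_isPositive {D : X →L[ℝ] X} (hD : D.IsPositive) {K : ℝ} (hK : 0 < K)
    (h : ∀ x, ⟪D x, x⟫_ℝ ≤ K * ‖x‖ ^ 2) (w : X) : ‖D w‖ ≤ K * ‖w‖ := by
  have h1 := norm_sq_apply_le hD hK h w
  have h2 := h w
  refine le_of_sq_le_sq ?_ (by positivity)
  nlinarith

/-- The sequence `T₀ = T`, `Tₙ₊₁ = Tₙ - Tₙ²`, for which `T x = ∑ Tₙ² x` when `0 ≤ T ≤ 1`. -/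
def rieszSeq (T : X →L[ℝ] X) : ℕ → X →L[ℝ] X
  | 0 => T
  | n + 1 => rieszSeq T n - rieszSeq T n * rieszSeq T n

/-- `T - T² = (1 - T) T (1 - T) + T (1 - T) T`, a sum of two positive operators. -/
theorem isPositive_sub_mul_self {T : X →L[ℝ] X} (h0 : T.IsPositive) (h1 : (1 - T).IsPositive) :
    (T - T * T).IsPositive := by
  refine isPositive_of_inner (fun x y => ?_) fun x => ?_
  · simp [inner_sub_left, inner_sub_right, h0.inner_left_eq_inner_right]
  · have h2 := h0.inner_nonneg_left (x - T x)
    have h3 := h1.inner_nonneg_left (T x)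
    have e1 : ⟪T (T x), x⟫_ℝ = ⟪T x, T x⟫_ℝ := h0.inner_left_eq_inner_right _ _
    simp only [map_sub, inner_sub_left, inner_sub_right, sub_apply,
      one_apply_eq_self, mul_apply_eq_comp] at h2 h3 ⊢
    linarith

theorem rieszSeq_spec {T : X →L[ℝ] X} (h0 : T.IsPositive) (h1 : (1 - T).IsPositive) (n : ℕ) :
    (rieszSeq T n).IsPositive ∧ (1 - rieszSeq T n).IsPositive := by
  induction n with
  | zero => exact ⟨h0, h1⟩
  | succ n ih =>
    refine ⟨isPositive_sub_mul_self ih.1 ih.2, ?_⟩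
    refine isPositive_of_inner (fun x y => ?_) fun x => ?_
    · simp [rieszSeq, inner_sub_left, inner_sub_right, ih.1.inner_left_eq_inner_right]
    · have h2 := ih.2.inner_nonneg_left x
      have h3 : ⟪rieszSeq T n (rieszSeq T n x), x⟫_ℝ = ‖rieszSeq T n x‖ ^ 2 := by
        rw [ih.1.inner_left_eq_inner_right, real_inner_self_eq_norm_sq]
      simp only [inner_sub_left, sub_apply, rieszSeq,
        one_apply_eq_self, mul_apply_eq_comp, h3] at h2 ⊢
      nlinarith [sq_nonneg ‖rieszSeq T n x‖]

theorem rieszSeq_commute {B T : X →L[ℝ] X} (h : Commute B T) (n : ℕ) :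
    Commute B (rieszSeq T n) := by
  induction n with
  | zero => exact h
  | succ n ih => exact ih.sub_right (ih.mul_right ih)

/-- `‖Tₙ x‖²` is the decrement of the nonnegative decreasing sequence `⟨Tₙ x, x⟩`, so it tends to
zero. -/
theorem tendsto_rieszSeq_apply {T : X →L[ℝ] X} (h0 : T.IsPositive) (h1 : (1 - T).IsPositive)
    (x : X) : Tendsto (fun n => rieszSeq T n x) atTop (𝓝 0) := by
  set p : ℕ → ℝ := fun n => ⟪rieszSeq T n x, x⟫_ℝ with hp
  have hstep : ∀ n, ‖rieszSeq T n x‖ ^ 2 = p n - p (n + 1) := fun n => by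
    have h3 : ⟪rieszSeq T n (rieszSeq T n x), x⟫_ℝ = ‖rieszSeq T n x‖ ^ 2 := by
      rw [(rieszSeq_spec h0 h1 n).1.inner_left_eq_inner_right, real_inner_self_eq_norm_sq]
    simp [hp, rieszSeq, inner_sub_left, h3]
  have hanti : Antitone p := antitone_nat_of_succ_le fun n => by
    have := hstep n
    nlinarith [sq_nonneg ‖rieszSeq T n x‖]
  have hbdd : BddBelow (range p) :=
    ⟨0, by rintro _ ⟨n, rfl⟩; exact (rieszSeq_spec h0 h1 n).1.inner_nonneg_left x⟩
  have hlim := tendsto_atTop_ciInf hanti hbdd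
  have hdiff := hlim.sub ((tendsto_add_atTop_iff_nat 1).2 hlim)
  rw [sub_self] at hdiff
  have hsq : Tendsto (fun n => ‖rieszSeq T n x‖ ^ 2) atTop (𝓝 0) := by
    simpa only [hstep] using hdiff
  have := hsq.sqrt
  simp only [Real.sqrt_sq (norm_nonneg _), Real.sqrt_zero] at this
  exact tendsto_zero_iff_norm_tendsto_zero.2 this

/-- The product of commuting positive operators is positive. -/
theorem inner_mul_nonneg {B T : X →L[ℝ] X} (hB : B.IsPositive) (h0 : T.IsPositive)
    (h1 : (1 - T).IsPositive) (hBT : Commute B T) (x : X) : 0 ≤ ⟪B (T x), x⟫_ℝ := by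
  -- Passing from `Tₙ` to `Tₙ₊₁` removes `B Tₙ² = Tₙ B Tₙ ≥ 0`, so these forms decrease; their limit
  -- is zero.
  have hle : ∀ n, ⟪B (rieszSeq T n x), x⟫_ℝ ≤ ⟪B (T x), x⟫_ℝ := fun n => by
    induction n with
    | zero => exact le_rfl
    | succ n ih =>
      refine le_trans ?_ ih
      have h2 := hB.inner_nonneg_left (rieszSeq T n x)
      have h3 : ⟪B (rieszSeq T n (rieszSeq T n x)), x⟫_ℝ
          = ⟪B (rieszSeq T n x), rieszSeq T n x⟫_ℝ := by
        have e : B (rieszSeq T n (rieszSeq T n x)) = rieszSeq T n (B (rieszSeq T n x)) :=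
          DFunLike.congr_fun (rieszSeq_commute hBT n).eq (rieszSeq T n x)
        rw [e, (rieszSeq_spec h0 h1 n).1.inner_left_eq_inner_right]
      simp only [rieszSeq, sub_apply, mul_apply_eq_comp, map_sub,
        inner_sub_left, h3]
      linarith
  have hlim : Tendsto (fun n => ⟪B (rieszSeq T n x), x⟫_ℝ) atTop (𝓝 0) := by
    have := Filter.Tendsto.inner (𝕜 := ℝ)
      ((B.continuous.tendsto 0).comp (tendsto_rieszSeq_apply h0 h1 x)) (tendsto_const_nhds (x := x))
    simpa using this
  exact le_of_tendsto' hlim hle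

theorem inner_le_metricNorm_mul {V : X →L[ℝ] X} {α : ℝ} (hα : 0 < α)
    (hV : α • (1 : X →L[ℝ] X) ≤ V) (x y : X) :
    ⟪V x, y⟫_ℝ ≤ metricNorm V x * metricNorm V y := by
  have hpos : ∀ x, 0 ≤ ⟪V x, x⟫_ℝ := fun x =>
    le_trans (by positivity) (mul_norm_sq_le_of_smul_one_le hV x)
  rcases eq_or_ne x 0 with rfl | hx
  · simp [metricNorm]
  rcases eq_or_ne y 0 with rfl | hy
  · simp [metricNorm]
  have hlt : ∀ x ≠ 0, 0 < metricNorm V x := fun x hx => Real.sqrt_pos.2 <|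
    lt_of_lt_of_le (by have := norm_pos_iff.2 hx; positivity) (mul_norm_sq_le_of_smul_one_le hV x)
  have ha := hlt x hx
  have hb := hlt y hy
  have ha2 : metricNorm V x ^ 2 = ⟪V x, x⟫_ℝ := Real.sq_sqrt (hpos x)
  have hb2 : metricNorm V y ^ 2 = ⟪V y, y⟫_ℝ := Real.sq_sqrt (hpos y)
  set a := metricNorm V x
  set b := metricNorm V y
  -- Cauchy–Schwarz: the form at this vector equals `2ab(ab - ⟨V x, y⟩)`, and `a`, `b` are positive.
  have h := hpos (b • x - a • y)
  have hs : ⟪V y, x⟫_ℝ = ⟪V x, y⟫_ℝ := by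
    rw [inner_symm_of_smul_one_le hV, real_inner_comm]
  simp only [map_sub, map_smul, inner_sub_left, inner_sub_right, real_inner_smul_left,
    real_inner_smul_right, hs, ← ha2, ← hb2] at h
  have h' : 0 ≤ (2 * (a * b)) * (a * b - ⟪V x, y⟫_ℝ) := by linarith
  have := nonneg_of_mul_nonneg_right h' (by positivity)
  linarith

theorem metricNorm_sq {V : X →L[ℝ] X} {α : ℝ} (hα : 0 < α)
    (hV : α • (1 : X →L[ℝ] X) ≤ V) (x : X) : metricNorm V x ^ 2 = ⟪V x, x⟫_ℝ :=
  Real.sq_sqrt (le_trans (by positivity) (mul_norm_sq_le_of_smul_one_le hV x))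

theorem metricNorm_nonneg (V : X →L[ℝ] X) (x : X) : 0 ≤ metricNorm V x := Real.sqrt_nonneg _

theorem metricNorm_add_le {V : X →L[ℝ] X} {α : ℝ} (hα : 0 < α)
    (hV : α • (1 : X →L[ℝ] X) ≤ V) (x y : X) :
    metricNorm V (x + y) ≤ metricNorm V x + metricNorm V y := by
  have h := inner_le_metricNorm_mul hα hV x y
  have hs : ⟪V y, x⟫_ℝ = ⟪V x, y⟫_ℝ := by
    rw [inner_symm_of_smul_one_le hV, real_inner_comm]
  refine le_of_sq_le_sq ?_ (add_nonneg (metricNorm_nonneg _ _) (metricNorm_nonneg _ _))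
  have e1 := metricNorm_sq hα hV x
  have e2 := metricNorm_sq hα hV y
  rw [metricNorm_sq hα hV]
  simp only [map_add, inner_add_left, inner_add_right, hs]
  nlinarith

theorem metricNorm_le_of_inner_le {V : X →L[ℝ] X} {C : ℝ} {x : X}
    (h : ⟪V x, x⟫_ℝ ≤ C ^ 2 * ‖x‖ ^ 2) (hC : 0 ≤ C) : metricNorm V x ≤ C * ‖x‖ := by
  refine Real.sqrt_le_iff.2 ⟨by positivity, ?_⟩
  rwa [mul_pow]

theorem apply_inverse_apply {A : X →L[ℝ] X} (hA : IsUnit A) (x : X) : A (Ring.inverse A x) = x :=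
  DFunLike.congr_fun (Ring.mul_inverse_cancel A hA) x

theorem inverse_apply_apply {A : X →L[ℝ] X} (hA : IsUnit A) (x : X) : Ring.inverse A (A x) = x :=
  DFunLike.congr_fun (Ring.inverse_mul_cancel A hA) x

theorem inner_inverse_symm {A : X →L[ℝ] X} (hA : IsUnit A)
    (hs : ∀ x y, ⟪A x, y⟫_ℝ = ⟪x, A y⟫_ℝ) (x y : X) :
    ⟪Ring.inverse A x, y⟫_ℝ = ⟪x, Ring.inverse A y⟫_ℝ := by
  conv_lhs => rw [← apply_inverse_apply hA y]
  rw [← hs, apply_inverse_apply hA]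

/-- Inversion of positive invertible operators reverses the Loewner order. -/
theorem inner_inverse_le {A B : X →L[ℝ] X} (hA : IsUnit A) (hB : IsUnit B) (hA0 : A.IsPositive)
    (h : ∀ x, ⟪A x, x⟫_ℝ ≤ ⟪B x, x⟫_ℝ) (x : X) :
    ⟪Ring.inverse B x, x⟫_ℝ ≤ ⟪Ring.inverse A x, x⟫_ℝ := by
  -- Expanding gives `⟨A B⁻¹x, B⁻¹x⟩ - 2⟨B⁻¹x, x⟩ + ⟨A⁻¹x, x⟩ ≥ 0`, whose first term is at most
  -- `⟨B⁻¹x, x⟩`.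
  have h1 := hA0.inner_nonneg_left (Ring.inverse B x - Ring.inverse A x)
  have h2 := h (Ring.inverse B x)
  rw [apply_inverse_apply hB] at h2
  have h3 : ⟪A (Ring.inverse B x), Ring.inverse A x⟫_ℝ = ⟪x, Ring.inverse B x⟫_ℝ := by
    rw [hA0.inner_left_eq_inner_right, apply_inverse_apply hA, real_inner_comm]
  simp only [map_sub, inner_sub_left, inner_sub_right, apply_inverse_apply hA, h3] at h1
  rw [real_inner_comm x (Ring.inverse B x), real_inner_comm x (Ring.inverse A x)] 
  linarith

theorem isPositive_of_smul_one_le {m : ℝ} (hm : 0 ≤ m) {A : X →L[ℝ] X}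
    (h : m • (1 : X →L[ℝ] X) ≤ A) : A.IsPositive :=
  isPositive_of_inner (inner_symm_of_smul_one_le h) fun x =>
    le_trans (by positivity) (mul_norm_sq_le_of_smul_one_le h x)

theorem inverse_smul {A : X →L[ℝ] X} (hA : IsUnit A) {c : ℝ} (hc : c ≠ 0) :
    Ring.inverse (c • A) = c⁻¹ • Ring.inverse A := by
  have hcA : IsUnit (c • A) := hA.smul (Units.mk0 c hc)
  rw [← Ring.inverse_mul_cancel_left (c • A) (c⁻¹ • Ring.inverse A) hcA, smul_mul_smul_comm,
    Ring.mul_inverse_cancel A hA, mul_inv_cancel₀ hc, one_smul, mul_one]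

variable [CompleteSpace X]

theorem isUnit_of_smul_one_le {m : ℝ} (hm : 0 < m) {A : X →L[ℝ] X}
    (h : m • (1 : X →L[ℝ] X) ≤ A) : IsUnit A := by
  refine ContinuousLinearMap.isUnit_of_forall_le_norm_inner_map A (c := ⟨m, hm.le⟩) hm fun x => ?_
  have := mul_norm_sq_le_of_smul_one_le h x
  rw [mul_comm]
  exact this.trans (le_abs_self _)

theorem inv_smul_one_le_inverse {m M : ℝ} (hm : 0 < m) {A : X →L[ℝ] X}
    (h : m • (1 : X →L[ℝ] X) ≤ A) (hM : 0 < M) (hAM : A ≤ M • (1 : X →L[ℝ] X)) :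
    M⁻¹ • (1 : X →L[ℝ] X) ≤ Ring.inverse A := by
  have hA := isUnit_of_smul_one_le hm h
  refine le_of_inner_le ?_ (inner_inverse_symm hA (inner_symm_of_smul_one_le h)) fun x => ?_
  · simp [real_inner_smul_left, real_inner_smul_right]
  rw [← Ring.inverse_one (X →L[ℝ] X), ← inverse_smul isUnit_one hM.ne']
  exact inner_inverse_le hA (isUnit_of_smul_one_le hM le_rfl) (isPositive_of_smul_one_le hm.le h)
    (inner_le_of_le hAM) x

theorem norm_inverse_le {m : ℝ} (hm : 0 < m) {A : X →L[ℝ] X}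
    (h : m • (1 : X →L[ℝ] X) ≤ A) : ‖Ring.inverse A‖ ≤ m⁻¹ := by
  have hA := isUnit_of_smul_one_le hm h
  refine ContinuousLinearMap.opNorm_le_bound _ (by positivity) fun x => ?_
  have h1 := mul_norm_sq_le_of_smul_one_le h (Ring.inverse A x)
  rw [apply_inverse_apply hA] at h1
  have h2 := real_inner_le_norm x (Ring.inverse A x)
  rw [inv_mul_eq_div, le_div_iff₀ hm]
  rcases (norm_nonneg (Ring.inverse A x)).eq_or_lt with h0 | h0
  · rw [← h0]; simp
  · refine le_of_mul_le_mul_right ?_ h0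
    nlinarith

end Operators

/-! ### Subgradients, minimizers and gradients of convex functions. -/

section Convex

variable {X : Type*} [NormedAddCommGroup X] [InnerProductSpace ℝ X]

/-- `v` is a subgradient of `g` at `q`; values of `g` are tested through the epigraph. -/
def IsSubgradient (g : X → EReal) (q v : X) : Prop :=
  ∃ s : ℝ, g q = s ∧ ∀ (u : X) (r : ℝ), g u ≤ r → s + ⟪v, u - q⟫_ℝ ≤ r

theorem IsSubgradient.monotone {g : X → EReal} {q q' v v' : X} (h : IsSubgradient g q v)
    (h' : IsSubgradient g q' v') : 0 ≤ ⟪v - v', q - q'⟫_ℝ := by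
  obtain ⟨s, hs, h⟩ := h
  obtain ⟨s', hs', h'⟩ := h'
  have h1 := h q' s' hs'.le
  have h2 := h' q s hs.le
  simp only [inner_sub_left, inner_sub_right] at *
  linarith

theorem IsGammaZero.exists_real {g : X → EReal} (hg : IsGammaZero g) {x : X} (hx : g x ≠ ⊤) :
    ∃ s : ℝ, g x = s :=
  ⟨(g x).toReal, (EReal.coe_toReal hx (hg.ne_bot x)).symm⟩

theorem IsGammaZero.le_combo {g : X → EReal} (hg : IsGammaZero g) {x y : X} {r s t : ℝ}
    (hx : g x ≤ r) (hy : g y ≤ s) (h0 : 0 ≤ t) (h1 : t ≤ 1) :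
    g (x + t • (y - x)) ≤ ((r + t * (s - r) : ℝ) : EReal) := by
  have := hg.convex (x := (x, r)) hx (y := (y, s)) hy (sub_nonneg.2 h1) h0 (by ring)
  simp only [mem_ofPred_eq, Prod.smul_mk, Prod.mk_add_mk, smul_eq_mul] at this
  convert this using 2
  · module
  · ring

/-- Properness makes the minimal value finite, so minimality becomes an inequality between reals
over the epigraph. Together with its converse below, this keeps extended-real arithmetic out of the
later proofs. -/
theorem argmin_add_finite {g : X → EReal} (hg : IsGammaZero g) {h : X → ℝ} {q : X}
    (hq : ∀ u, (h q : EReal) + g q ≤ h u + g u) :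
    ∃ s : ℝ, g q = s ∧ ∀ (u : X) (r : ℝ), g u ≤ r → h q + s ≤ h u + r := by
  have key : ∀ (u : X) (r : ℝ), g u ≤ r → (h q : EReal) + g q ≤ ((h u + r : ℝ) : EReal) :=
    fun u r hr => (hq u).trans (by rw [EReal.coe_add]; gcongr)
  have hfin : g q ≠ ⊤ := fun htop => by
    obtain ⟨x₀, hx₀⟩ := hg.proper
    obtain ⟨s, hs⟩ := hg.exists_real hx₀
    have h1 := key x₀ s hs.le
    rw [htop, EReal.coe_add_top, top_le_iff] at h1
    exact EReal.coe_ne_top _ h1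
  obtain ⟨s, hs⟩ := hg.exists_real hfin
  refine ⟨s, hs, fun u r hr => ?_⟩
  have h1 := key u r hr
  rw [hs, ← EReal.coe_add] at h1
  exact EReal.coe_le_coe_iff.1 h1

theorem argmin_add_of_forall {g : X → EReal} (hg : IsGammaZero g) {h : X → ℝ} {q : X} {s : ℝ}
    (hs : g q ≤ s) (H : ∀ (u : X) (r : ℝ), g u ≤ r → h q + s ≤ h u + r) (u : X) :
    (h q : EReal) + g q ≤ h u + g u := by
  rcases eq_or_ne (g u) ⊤ with hu | hu
  · rw [hu, EReal.coe_add_top]; exact le_top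
  · obtain ⟨r, hr⟩ := hg.exists_real hu
    calc (h q : EReal) + g q ≤ h q + s := by gcongr
      _ ≤ h u + r := by exact_mod_cast H u r hr.le
      _ = h u + g u := by rw [hr]

theorem isClosed_argmin {g : X → EReal} (hg : IsGammaZero g) {f : X → ℝ} (hf : Continuous f) :
    IsClosed (Argmin fun z => (f z : EReal) + g z) := by
  rcases eq_empty_or_nonempty (Argmin fun z => (f z : EReal) + g z) with h | ⟨z, hz⟩
  · rw [h]; exact isClosed_empty
  obtain ⟨s, hs, H⟩ := argmin_add_finite hg hz
  -- With minimal value `f z + s`, the minimizers are the points `u` for which `(u, f z + s - f u)`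
  -- lies in the closed epigraph.
  have : (Argmin fun z => (f z : EReal) + g z)
      = (fun u => (u, f z + s - f u)) ⁻¹' {p : X × ℝ | g p.1 ≤ (p.2 : EReal)} := by
    ext u
    constructor
    · intro hu
      obtain ⟨r, hr, H'⟩ := argmin_add_finite hg hu
      have := H' z s hs.le
      simp only [mem_preimage, mem_ofPred_eq, hr, EReal.coe_le_coe_iff]
      linarith
    · intro hu
      refine argmin_add_of_forall hg hu fun w r hr => ?_
      have := H w r hr
      linarith
  rw [this]
  exact hg.lsc.preimage (by fun_prop)

theorem convex_argmin {g : X → EReal} (hg : IsGammaZero g) {f : X → ℝ} (hf : ConvexOn ℝ univ f) :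
    Convex ℝ (Argmin fun z => (f z : EReal) + g z) := by
  intro x hx y hy a b ha hb hab
  obtain ⟨r, hr, H⟩ := argmin_add_finite hg hx
  obtain ⟨s, hs, H'⟩ := argmin_add_finite hg hy
  have h1 := hg.le_combo hr.le hs.le hb (by linarith : b ≤ 1)
  have h2 := hf.2 (mem_univ x) (mem_univ y) ha hb hab
  obtain rfl : a = 1 - b := by linarith
  rw [show (1 - b) • x + b • y = x + b • (y - x) by module] at h2 ⊢
  refine argmin_add_of_forall hg h1 fun w c hc => ?_
  have h3 := H w c hc
  have h4 := H' w c hc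
  simp only [smul_eq_mul] at h2
  nlinarith

section Gradient

variable [CompleteSpace X]

theorem hasDerivAt_line {h : X → ℝ} {v x d : X} {t : ℝ} (hv : HasGradientAt h v (x + t • d)) :
    HasDerivAt (fun s : ℝ => h (x + s • d)) ⟪v, d⟫_ℝ t := by
  have h1 : HasDerivAt (fun s : ℝ => x + s • d) d t := by
    simpa using ((hasDerivAt_id t).smul_const d).const_add x
  have h2 := (hasGradientAt_iff_hasFDerivAt.1 hv).comp_hasDerivAt t h1
  exact h2.congr_deriv (by simp)

theorem inner_le_of_forall_line {h : X → ℝ} {v q d : X} (hv : HasGradientAt h v q) {c : ℝ}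
    (H : ∀ t ∈ Ioo (0 : ℝ) 1, h (q + t • d) - h q ≤ t * c) : ⟪v, d⟫_ℝ ≤ c := by
  have h1 : HasDerivAt (fun s : ℝ => h (q + s • d)) ⟪v, d⟫_ℝ 0 := hasDerivAt_line (by simpa using hv)
  have h2 := h1.tendsto_slope_zero_right
  refine le_of_tendsto h2 ?_
  filter_upwards [Ioo_mem_nhdsGT (zero_lt_one' ℝ)] with t ht
  have := H t ht
  simp only [zero_add, zero_smul, add_zero, smul_eq_mul]
  rwa [inv_mul_le_iff₀ ht.1]

theorem le_inner_of_forall_line {h : X → ℝ} {v q d : X} (hv : HasGradientAt h v q) {c : ℝ}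
    (H : ∀ t ∈ Ioo (0 : ℝ) 1, t * c ≤ h (q + t • d) - h q) : c ≤ ⟪v, d⟫_ℝ := by
  have h1 : HasDerivAt (fun s : ℝ => h (q + s • d)) ⟪v, d⟫_ℝ 0 := hasDerivAt_line (by simpa using hv)
  have h2 := h1.tendsto_slope_zero_right
  refine ge_of_tendsto h2 ?_
  filter_upwards [Ioo_mem_nhdsGT (zero_lt_one' ℝ)] with t ht
  have := H t ht
  simp only [zero_add, zero_smul, add_zero, smul_eq_mul]
  rwa [le_inv_mul_iff₀ ht.1]

/-- Fermat's rule for the sum of a differentiable function and a function in `Γ₀`. -/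
theorem isSubgradient_of_argmin {g : X → EReal} (hg : IsGammaZero g) {h : X → ℝ} {q v : X}
    (hv : HasGradientAt h v q) (hq : ∀ u, (h q : EReal) + g q ≤ h u + g u) :
    IsSubgradient g q (-v) := by
  obtain ⟨s, hs, H⟩ := argmin_add_finite hg hq
  refine ⟨s, hs, fun u r hr => ?_⟩
  -- Convexity bounds the increment of `g` along the segment by `t (r - s)`; minimality then bounds
  -- that of `h` below by `t (s - r)`.
  have : s - r ≤ ⟪v, u - q⟫_ℝ := le_inner_of_forall_line hv fun t ht => by
    have := H _ _ (hg.le_combo hs.le hr ht.1.le ht.2.le)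
    linarith
  rw [inner_neg_left]
  linarith

theorem gradient_inequality {f : X → ℝ} (hf : ConvexOn ℝ univ f) (hd : Differentiable ℝ f)
    (x y : X) : f x + ⟪gradient f x, y - x⟫_ℝ ≤ f y := by
  have : ⟪gradient f x, y - x⟫_ℝ ≤ f y - f x :=
    inner_le_of_forall_line (hd x).hasGradientAt fun t ht => by
      have := hf.2 (mem_univ x) (mem_univ y) (sub_nonneg.2 ht.2.le) ht.1.le (by ring)
      rw [show (1 - t) • x + t • y = x + t • (y - x) by module] at this
      simp only [smul_eq_mul] at this
      linarith
  linarith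

theorem argmin_of_isSubgradient {g : X → EReal} (hg : IsGammaZero g) {f : X → ℝ}
    (hf : ConvexOn ℝ univ f) (hd : Differentiable ℝ f) {q : X}
    (hq : IsSubgradient g q (-gradient f q)) : q ∈ Argmin fun z => (f z : EReal) + g z := by
  obtain ⟨s, hs, H⟩ := hq
  refine argmin_add_of_forall hg hs.le fun u r hr => ?_
  have h1 := H u r hr
  have h2 := gradient_inequality hf hd q u
  rw [inner_neg_left] at h1
  linarith

/-- The descent lemma for functions with Lipschitz gradient. -/
theorem descent_lemma {f : X → ℝ} (hd : Differentiable ℝ f) {L : ℝ}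
    (hL : ∀ x y : X, ‖gradient f x - gradient f y‖ ≤ L * ‖x - y‖) (x d : X) :
    f (x + d) ≤ f x + ⟪gradient f x, d⟫_ℝ + L / 2 * ‖d‖ ^ 2 := by
  -- The gap along the segment between `f` and its quadratic upper model; its derivative is
  -- nonpositive for `t ≥ 0`.
  let ψ : ℝ → ℝ := fun t => f (x + t • d) - t * ⟪gradient f x, d⟫_ℝ - L / 2 * ‖d‖ ^ 2 * t ^ 2
  have hψ : ∀ t, HasDerivAt ψ
      (⟪gradient f (x + t • d), d⟫_ℝ - ⟪gradient f x, d⟫_ℝ - L * ‖d‖ ^ 2 * t) t := fun t => by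
    have h1 := hasDerivAt_line (hd (x + t • d)).hasGradientAt
    have h2 := (hasDerivAt_id t).mul_const ⟪gradient f x, d⟫_ℝ
    have h3 := ((hasDerivAt_id t).pow 2).const_mul (L / 2 * ‖d‖ ^ 2)
    refine ((h1.sub h2).sub h3).congr_deriv ?_
    simp
    ring
  have hanti : AntitoneOn ψ (Ici 0) := by
    refine antitoneOn_of_deriv_nonpos (convex_Ici 0)
      (fun t _ => (hψ t).continuousAt.continuousWithinAt)
      (fun t _ => (hψ t).differentiableAt.differentiableWithinAt) fun t ht => ?_
    rw [interior_Ici, mem_Ioi] at ht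
    rw [(hψ t).deriv, ← inner_sub_left]
    have h1 := real_inner_le_norm (gradient f (x + t • d) - gradient f x) d
    have h2 := hL (x + t • d) x
    rw [add_sub_cancel_left, norm_smul, Real.norm_of_nonneg ht.le] at h2
    have h3 := mul_le_mul_of_nonneg_right h2 (norm_nonneg d)
    nlinarith
  have := hanti (mem_Ici.2 le_rfl) (mem_Ici.2 zero_le_one) zero_le_one
  simp only [ψ, one_smul, zero_smul, add_zero] at this
  linarith

/-- The Baillon–Haddad theorem: a Lipschitz gradient of a convex function is cocoercive. -/
theorem gradient_cocoercive {f : X → ℝ} (hf : ConvexOn ℝ univ f) (hd : Differentiable ℝ f) {β : ℝ}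
    (hβ : 0 < β) (hL : ∀ x y : X, ‖gradient f x - gradient f y‖ ≤ 1 / β * ‖x - y‖) (x y : X) :
    β * ‖gradient f x - gradient f y‖ ^ 2 ≤ ⟪gradient f x - gradient f y, x - y⟫_ℝ := by
  -- Compare, at the point `y - β (∇f y - ∇f x)`, the descent lemma based at `y` with the tangent
  -- inequality at `x`. Adding this estimate to the one with `x` and `y` exchanged gives
  -- cocoercivity.
  have key : ∀ x y, f x + ⟪gradient f x, y - x⟫_ℝ + β / 2 * ‖gradient f y - gradient f x‖ ^ 2
      ≤ f y := fun x y => by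
    have h1 := descent_lemma hd hL y (-(β • (gradient f y - gradient f x)))
    have h2 := gradient_inequality hf hd x (y + -(β • (gradient f y - gradient f x)))
    set w := gradient f y - gradient f x with hw
    have e : ⟪gradient f y, w⟫_ℝ - ⟪gradient f x, w⟫_ℝ = ‖w‖ ^ 2 := by
      rw [← inner_sub_left, ← hw, real_inner_self_eq_norm_sq]
    rw [show y + -(β • w) - x = (y - x) - β • w by module] at h2
    rw [norm_neg, norm_smul, Real.norm_of_nonneg hβ.le, mul_pow, inner_neg_right,
      real_inner_smul_right] at h1
    rw [inner_sub_right, real_inner_smul_right] at h2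
    have e2 : 1 / β / 2 * (β ^ 2 * ‖w‖ ^ 2) = β / 2 * ‖w‖ ^ 2 := by field_simp
    rw [e2] at h1
    have e3 : β * (⟪gradient f y, w⟫_ℝ - ⟪gradient f x, w⟫_ℝ) = β * ‖w‖ ^ 2 := by rw [e]
    linarith
  have h1 := key x y
  have h2 := key y x
  rw [norm_sub_rev] at h1
  simp only [inner_sub_left, inner_sub_right] at *
  linarith

end Gradient

end Convex

/-! ### Existence and characterization of proximal points; weak closedness. -/

section Prox

/-- A Cauchy criterion satisfied by minimizing sequences of strongly convex functions. -/
theorem exists_tendsto_of_norm_sq_le {E : Type*} [NormedAddCommGroup E] [CompleteSpace E]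
    {u : ℕ → E} {C : ℝ}
    (h : ∀ n k, ‖u n - u k‖ ^ 2 ≤ C * (1 / ((n : ℝ) + 1) + 1 / ((k : ℝ) + 1))) :
    ∃ q, Tendsto u atTop (𝓝 q) := by
  have hC : 0 ≤ C := by
    have := (sq_nonneg _).trans (h 0 0)
    norm_num at this
    linarith
  refine cauchySeq_tendsto_of_complete <|
    cauchySeq_of_le_tendsto_0 (fun N : ℕ => √(C * (2 * (1 / ((N : ℝ) + 1))))) ?_ ?_
  · intro n k N hn hk
    rw [dist_eq_norm]
    refine Real.le_sqrt_of_sq_le ((h n k).trans ?_)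
    have h1 : 1 / ((n : ℝ) + 1) ≤ 1 / ((N : ℝ) + 1) := by gcongr
    have h2 : 1 / ((k : ℝ) + 1) ≤ 1 / ((N : ℝ) + 1) := by gcongr
    gcongr
    linarith
  · have := ((tendsto_one_div_add_atTop_nhds_zero_nat (𝕜 := ℝ)).const_mul 2).const_mul C
    simpa using this.sqrt

variable {X : Type*} [NormedAddCommGroup X] [InnerProductSpace ℝ X]

/-- A function in `Γ₀` decreases at most linearly. -/
theorem IsGammaZero.exists_linear_minorant {g : X → EReal} (hg : IsGammaZero g) (x₀ : X) {s₀ : ℝ}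
    (hs₀ : g x₀ = s₀) :
    ∃ K : ℝ, 0 ≤ K ∧ ∀ (u : X) (r : ℝ), g u ≤ r → s₀ - 1 - K * ‖u - x₀‖ ≤ r := by
  -- A ball around this point off the closed epigraph bounds `g` below near `x₀`; convexity extends
  -- the bound to all of the space.
  have hnot : (x₀, s₀ - 1) ∈ {p : X × ℝ | g p.1 ≤ (p.2 : EReal)}ᶜ := by
    simp only [mem_compl_iff, mem_ofPred_eq, hs₀, EReal.coe_le_coe_iff]
    linarith
  obtain ⟨δ, hδ, hball⟩ := Metric.isOpen_iff.1 hg.lsc.isOpen_compl _ hnot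
  have hloc : ∀ (u : X) (r : ℝ), ‖u - x₀‖ < δ → g u ≤ r → s₀ - 1 ≤ r := fun u r hu hr => by
    by_contra! hlt
    have hmem : (u, s₀ - 1) ∈ Metric.ball (x₀, s₀ - 1) δ := by
      rw [Metric.mem_ball, Prod.dist_eq]
      simp [dist_eq_norm, hu]
    exact hball hmem (hr.trans (EReal.coe_le_coe_iff.2 hlt.le))
  refine ⟨2 / δ, by positivity, fun u r hr => ?_⟩
  rcases lt_or_ge ‖u - x₀‖ δ with hu | hu
  · have := hloc u r hu hr
    have : 0 ≤ 2 / δ * ‖u - x₀‖ := by positivity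
    linarith
  · have hn : 0 < ‖u - x₀‖ := hδ.trans_le hu
    -- This `t` brings the point on the segment to distance `δ / 2` from `x₀`, inside the ball.
    set t := δ / (2 * ‖u - x₀‖) with ht
    have ht0 : 0 < t := by positivity
    have ht1 : t ≤ 1 := by
      rw [ht, div_le_one (by positivity)]; linarith
    have h1 := hloc _ _ (by
      rw [add_sub_cancel_left, norm_smul, Real.norm_of_nonneg ht0.le, ht]
      field_simp
      linarith) (hg.le_combo hs₀.le hr ht0.le ht1)
    have h2 : t * (2 / δ * ‖u - x₀‖) = 1 := by rw [ht]; field_simp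
    have h3 : 0 ≤ t * (r - s₀ + 2 / δ * ‖u - x₀‖) := by linarith
    have h4 := nonneg_of_mul_nonneg_right h3 ht0
    linarith

/-- Direct method: the linear minorant keeps the infimum finite, strong convexity of the quadratic
term makes a minimizing sequence Cauchy, and the closed epigraph contains the limit. -/
theorem exists_argmin_quadratic_add [CompleteSpace X] {g : X → EReal} (hg : IsGammaZero g)
    {V : X →L[ℝ] X} {α : ℝ} (hα : 0 < α) (hV : α • (1 : X →L[ℝ] X) ≤ V) {κ : ℝ} (hκ : 0 < κ) (y : X) :
    ∃ q, ∀ u, ((κ * ⟪V (y - q), y - q⟫_ℝ : ℝ) : EReal) + g q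
      ≤ (κ * ⟪V (y - u), y - u⟫_ℝ : ℝ) + g u := by
  obtain ⟨x₀, hx₀⟩ := hg.proper
  obtain ⟨s₀, hs₀⟩ := hg.exists_real hx₀
  obtain ⟨K, hK, hmin⟩ := hg.exists_linear_minorant x₀ hs₀
  set Q : X → ℝ := fun w => κ * ⟪V w, w⟫_ℝ with hQ
  have hQlow : ∀ w, κ * α * ‖w‖ ^ 2 ≤ Q w := fun w => by
    have := mul_le_mul_of_nonneg_left (mul_norm_sq_le_of_smul_one_le hV w) hκ.le
    rwa [← mul_assoc] at this
  have hQcont : Continuous Q := by fun_prop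
  have hsymm : ∀ a b, ⟪V b, a⟫_ℝ = ⟪V a, b⟫_ℝ := fun a b => by
    rw [inner_symm_of_smul_one_le hV, real_inner_comm]
  -- Parallelogram identity for the quadratic form.
  have hmid : ∀ a b, Q (y - (a + (1 / 2 : ℝ) • (b - a)))
      = Q (y - a) / 2 + Q (y - b) / 2 - Q (a - b) / 4 := fun a b => by
    rw [show y - (a + (1 / 2 : ℝ) • (b - a)) = (1 / 2 : ℝ) • ((y - a) + (y - b)) by module,
      show a - b = (y - b) - (y - a) by module]
    simp only [hQ, map_add, map_sub, map_smul, inner_add_left, inner_sub_left, inner_add_right,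
      inner_sub_right, real_inner_smul_left, real_inner_smul_right, hsymm y a, hsymm y b,
      hsymm a b]
    ring
  set S : Set ℝ := {c | ∃ (u : X) (r : ℝ), g u ≤ r ∧ c = Q (y - u) + r} with hS
  have hne : S.Nonempty := ⟨_, x₀, s₀, hs₀.le, rfl⟩
  have hbdd : BddBelow S := by
    -- The last term completes the square in `κα‖y - u‖² - K‖y - u‖`.
    refine ⟨s₀ - 1 - K * ‖y - x₀‖ - K ^ 2 / (4 * (κ * α)), ?_⟩
    rintro _ ⟨u, r, hr, rfl⟩
    have h1 := hmin u r hr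
    have h2 := hQlow (y - u)
    have h3 : ‖u - x₀‖ ≤ ‖y - u‖ + ‖y - x₀‖ := by
      rw [show u - x₀ = -(y - u) + (y - x₀) by module, ← norm_neg (y - u)]
      exact norm_add_le _ _
    have h4 := mul_le_mul_of_nonneg_left h3 hK
    have hκα : 0 < κ * α := by positivity
    have h5 : 0 ≤ κ * α * ‖y - u‖ ^ 2 - K * ‖y - u‖ + K ^ 2 / (4 * (κ * α)) := by
      have : κ * α * ‖y - u‖ ^ 2 - K * ‖y - u‖ + K ^ 2 / (4 * (κ * α))
          = κ * α * (‖y - u‖ - K / (2 * (κ * α))) ^ 2 := by field_simp; ring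
      rw [this]; positivity
    linarith
  set m := sInf S with hm
  have hmle : ∀ u (r : ℝ), g u ≤ r → m ≤ Q (y - u) + r := fun u r hr =>
    csInf_le hbdd ⟨u, r, hr, rfl⟩
  have happ : ∀ n : ℕ, ∃ (u : X) (r : ℝ), g u ≤ r ∧ Q (y - u) + r < m + 1 / ((n : ℝ) + 1) :=
    fun n => by
      obtain ⟨_, ⟨u, r, hr, rfl⟩, hlt⟩ := exists_lt_of_csInf_lt hne
        (lt_add_of_pos_right m (Nat.one_div_pos_of_nat (n := n)))
      exact ⟨u, r, hr, hlt⟩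
  choose u r hur hlt using happ
  obtain ⟨q, hq⟩ : ∃ q, Tendsto u atTop (𝓝 q) := by
    refine exists_tendsto_of_norm_sq_le (C := 2 / (κ * α)) fun n k => ?_
    have h1 := hmle _ _ (hg.le_combo (hur n) (hur k) (t := 1 / 2) (by norm_num) (by norm_num))
    rw [hmid] at h1
    have h2 := hQlow (u n - u k)
    have h3 := hlt n
    have h4 := hlt k
    rw [div_mul_eq_mul_div, le_div_iff₀ (by positivity)]
    linarith
  have hval : Tendsto (fun n => Q (y - u n) + r n) atTop (𝓝 m) := by
    refine tendsto_of_tendsto_of_tendsto_of_le_of_le tendsto_const_nhds ?_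
      (fun n => hmle _ _ (hur n)) fun n => (hlt n).le
    simpa using (tendsto_one_div_add_atTop_nhds_zero_nat (𝕜 := ℝ)).const_add m
  have hQlim : Tendsto (fun n => Q (y - u n)) atTop (𝓝 (Q (y - q))) :=
    (hQcont.tendsto _).comp (hq.const_sub y)
  have hr : Tendsto r atTop (𝓝 (m - Q (y - q))) := by
    simpa using hval.sub hQlim
  have hmem : g q ≤ ((m - Q (y - q) : ℝ) : EReal) :=
    hg.lsc.mem_of_tendsto (hq.prodMk_nhds hr) (Eventually.of_forall hur)
  refine ⟨q, argmin_add_of_forall hg hmem (h := fun u => Q (y - u)) fun w c hc => ?_⟩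
  have := hmle w c hc
  linarith

/-- Existence alone makes the choice in `prox` a minimizer; uniqueness is not needed. -/
theorem prox_mem_argmin [CompleteSpace X] {g : X → EReal} (hg : IsGammaZero g)
    {V : X →L[ℝ] X} {α : ℝ} (hα : 0 < α) (hV : α • (1 : X →L[ℝ] X) ≤ V) {τ : ℝ} (hτ : 0 < τ) (y : X) :
    prox V τ g y ∈ Argmin (proxObjective V τ g y) := by
  obtain ⟨q, hq⟩ := exists_argmin_quadratic_add hg hα hV (κ := 1 / (2 * τ)) (by positivity) y
  refine Classical.epsilon_spec (p := fun p => p ∈ Argmin (proxObjective V τ g y)) ⟨q, fun u => ?_⟩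
  simpa only [proxObjective, metricNorm_sq hα hV, add_comm (g _)] using hq u

theorem hasGradientAt_quadratic [CompleteSpace X] {V : X →L[ℝ] X}
    (hV : ∀ x y, ⟪V x, y⟫_ℝ = ⟪x, V y⟫_ℝ) (κ : ℝ) (y q : X) :
    HasGradientAt (fun u => κ * ⟪V (y - u), y - u⟫_ℝ) (-((2 * κ) • V (y - q))) q := by
  rw [hasGradientAt_iff_hasFDerivAt]
  have h1 : HasFDerivAt (fun u : X => y - u) (-ContinuousLinearMap.id ℝ X) q :=
    (hasFDerivAt_id q).const_sub y
  have h2 := ((V.hasFDerivAt.comp q h1).inner ℝ h1).const_mul κ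
  refine h2.congr_fderiv ?_
  ext d
  have e : ⟪V d, y - q⟫_ℝ = ⟪V (y - q), d⟫_ℝ := by rw [hV, real_inner_comm]
  simp [fderivInnerCLM_apply, e, -map_sub]
  ring

theorem isSubgradient_prox [CompleteSpace X] {g : X → EReal} (hg : IsGammaZero g)
    {V : X →L[ℝ] X} {α : ℝ} (hα : 0 < α) (hV : α • (1 : X →L[ℝ] X) ≤ V) {τ : ℝ} (hτ : 0 < τ) (y : X) :
    IsSubgradient g (prox V τ g y) (τ⁻¹ • V (y - prox V τ g y)) := by
  have h := isSubgradient_of_argmin hg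
    (hasGradientAt_quadratic (inner_symm_of_smul_one_le hV) (1 / (2 * τ)) y (prox V τ g y))
    fun u => by
      simpa only [proxObjective, metricNorm_sq hα hV, add_comm (g _)]
        using prox_mem_argmin hg hα hV hτ y u
  rw [neg_neg] at h
  convert h using 2
  field_simp

/-- The epigraph of a function in `Γ₀` is weakly closed. -/
theorem IsGammaZero.le_of_weak_tendsto {g : X → EReal} (hg : IsGammaZero g) {ι : Type*}
    {l : Filter ι} [l.NeBot] {q : ι → X} {r : ι → ℝ} {x : X} {c : ℝ} [CompleteSpace X]
    (hq : ∀ u, Tendsto (fun i => ⟪q i, u⟫_ℝ) l (𝓝 ⟪x, u⟫_ℝ)) (hr : Tendsto r l (𝓝 c))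
    (h : ∀ i, g (q i) ≤ r i) : g x ≤ c := by
  by_contra hnot
  obtain ⟨F, s, hs, hF⟩ := geometric_hahn_banach_point_closed (x := (x, c)) hg.convex hg.lsc hnot
  set F₁ : StrongDual ℝ X := F.comp (ContinuousLinearMap.inl ℝ X ℝ) with hF₁
  -- Riesz representation splits the separating functional into an inner product and a multiple of
  -- the real coordinate, so it passes to the limit.
  have hsplit : ∀ (u : X) (t : ℝ), F (u, t) = ⟪u, (InnerProductSpace.toDual ℝ X).symm F₁⟫_ℝ
      + t * F (0, 1) := fun u t => by
    rw [real_inner_comm, InnerProductSpace.toDual_symm_apply]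
    have : (u, t) = (u, (0 : ℝ)) + t • ((0 : X), (1 : ℝ)) := by simp
    rw [this, map_add, map_smul]
    simp [hF₁]
  have hlim : Tendsto (fun i => F (q i, r i)) l (𝓝 (F (x, c))) := by
    rw [hsplit x c]
    exact ((hq _).add (hr.mul_const _)).congr fun i => (hsplit _ _).symm
  have := ge_of_tendsto' hlim fun i => (hF (q i, r i) (h i)).le
  linarith

theorem tendsto_inner_of_weak {ι : Type*} {l : Filter ι} {q v : ι → X} {x w : X} {C : ℝ}
    (hC : ∀ i, ‖q i‖ ≤ C) (hq : ∀ u, Tendsto (fun i => ⟪q i, u⟫_ℝ) l (𝓝 ⟪x, u⟫_ℝ))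
    (hv : Tendsto v l (𝓝 w)) : Tendsto (fun i => ⟪q i, v i⟫_ℝ) l (𝓝 ⟪x, w⟫_ℝ) := by
  have h1 : Tendsto (fun i => ⟪q i, v i - w⟫_ℝ) l (𝓝 0) := by
    have h2 : Tendsto (fun i => C * ‖v i - w‖) l (𝓝 0) := by
      simpa using (tendsto_iff_norm_sub_tendsto_zero.1 hv).const_mul C
    refine squeeze_zero_norm (fun i => ?_) h2
    exact (norm_inner_le_norm _ _).trans (by gcongr; exact hC i)
  have := h1.add (hq w)
  simpa [inner_sub_right] using this

/-- The graph of the subdifferential is sequentially closed for the weak-strong topology. -/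
theorem IsSubgradient.of_weak_tendsto {g : X → EReal} (hg : IsGammaZero g) {ι : Type*}
    {l : Filter ι} [l.NeBot] {q v : ι → X} {x w : X} {C : ℝ} [CompleteSpace X]
    (h : ∀ i, IsSubgradient g (q i) (v i)) (hC : ∀ i, ‖q i‖ ≤ C)
    (hq : ∀ u, Tendsto (fun i => ⟪q i, u⟫_ℝ) l (𝓝 ⟪x, u⟫_ℝ)) (hv : Tendsto v l (𝓝 w)) :
    IsSubgradient g x w := by
  -- For fixed `(u, r)` the subgradient inequality places a point in the epigraph, which is weakly
  -- closed.
  have key : ∀ (u : X) (r : ℝ), g u ≤ r → g x ≤ ((r - ⟪w, u - x⟫_ℝ : ℝ) : EReal) := by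
    intro u r hr
    refine hg.le_of_weak_tendsto (r := fun i => r - ⟪v i, u - q i⟫_ℝ) hq ?_ fun i => ?_
    · have h1 : Tendsto (fun i => ⟪v i, q i⟫_ℝ) l (𝓝 ⟪w, x⟫_ℝ) := by
        rw [real_inner_comm x w]
        exact (tendsto_inner_of_weak hC hq hv).congr fun i => real_inner_comm _ _
      have h2 : Tendsto (fun i => ⟪v i, u⟫_ℝ) l (𝓝 ⟪w, u⟫_ℝ) :=
        Filter.Tendsto.inner (𝕜 := ℝ) hv tendsto_const_nhds
      simpa only [inner_sub_right] using (h2.sub h1).const_sub r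
    · obtain ⟨s, hs, H⟩ := h i
      rw [hs, EReal.coe_le_coe_iff]
      linarith [H u r hr]
  obtain ⟨x₀, hx₀⟩ := hg.proper
  obtain ⟨s₀, hs₀⟩ := hg.exists_real hx₀
  obtain ⟨s, hs⟩ := hg.exists_real (ne_top_of_le_ne_top (EReal.coe_ne_top _) (key x₀ s₀ hs₀.le))
  refine ⟨s, hs, fun u r hr => ?_⟩
  have := key u r hr
  rw [hs, EReal.coe_le_coe_iff] at this
  linarith

end Prox

/-! ### Quasi-decreasing sequences and weak convergence in variable metrics. -/

section QuasiFejer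

theorem exists_tendsto_prod_one_add {η : ℕ → ℝ} (h0 : ∀ k, 0 ≤ η k) (hs : Summable η) :
    ∃ c, Tendsto (fun k => ∏ i ∈ Finset.range k, (1 + η i)) atTop (𝓝 c) := by
  refine ⟨_, tendsto_atTop_ciSup (monotone_nat_of_le_succ fun k => ?_)
    ⟨Real.exp (∑' i, η i), ?_⟩⟩
  · rw [Finset.prod_range_succ]
    exact le_mul_of_one_le_right (Finset.prod_nonneg fun i _ => by linarith [h0 i])
      (by linarith [h0 k])
  · rintro _ ⟨k, rfl⟩
    calc ∏ i ∈ Finset.range k, (1 + η i) ≤ ∏ i ∈ Finset.range k, Real.exp (η i) :=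
          Finset.prod_le_prod (fun i _ => by linarith [h0 i]) fun i _ => by
            linarith [Real.add_one_le_exp (η i)]
      _ = Real.exp (∑ i ∈ Finset.range k, η i) := (Real.exp_sum _ _).symm
      _ ≤ _ := Real.exp_le_exp.2 (hs.sum_le_tsum _ fun i _ => h0 i)

theorem one_le_prod_one_add {η : ℕ → ℝ} (h0 : ∀ k, 0 ≤ η k) (k : ℕ) :
    1 ≤ ∏ i ∈ Finset.range k, (1 + η i) := by
  induction k with
  | zero => simp
  | succ k ih =>
    rw [Finset.prod_range_succ]
    nlinarith [h0 k]

/-- Dividing by the partial products of `1 + η i` and subtracting the partial sums of `ε` leaves a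
decreasing sequence bounded below; both corrections converge. -/
theorem exists_tendsto_of_quasi_decreasing {a η ε : ℕ → ℝ} (ha : ∀ k, 0 ≤ a k)
    (hη : ∀ k, 0 ≤ η k) (hηs : Summable η) (hε : ∀ k, 0 ≤ ε k) (hεs : Summable ε)
    (h : ∀ k, a (k + 1) ≤ (1 + η k) * a k + ε k) : ∃ ℓ, Tendsto a atTop (𝓝 ℓ) := by
  set c : ℕ → ℝ := fun k => ∏ i ∈ Finset.range k, (1 + η i) with hc
  obtain ⟨C, hC⟩ := exists_tendsto_prod_one_add hη hηs
  have hc1 : ∀ k, 1 ≤ c k := one_le_prod_one_add hη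
  have hcs : ∀ k, c (k + 1) = c k * (1 + η k) := fun k => Finset.prod_range_succ _ _
  have hstep : ∀ k, a (k + 1) / c (k + 1) ≤ a k / c k + ε k := fun k => by
    have h1 := hc1 k
    have h2 := hc1 (k + 1)
    have h3 := hη k
    rw [div_le_iff₀ (by linarith)]
    have e : (a k / c k + ε k) * c (k + 1) = (1 + η k) * a k + ε k * c (k + 1) := by
      rw [hcs]; field_simp
    rw [e]
    have := le_mul_of_one_le_right (hε k) h2
    linarith [h k]
  set b : ℕ → ℝ := fun k => a k / c k - ∑ i ∈ Finset.range k, ε i with hb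
  have hanti : Antitone b := antitone_nat_of_succ_le fun k => by
    simp only [hb, Finset.sum_range_succ]
    linarith [hstep k]
  have hbdd : BddBelow (range b) := by
    refine ⟨-∑' i, ε i, ?_⟩
    rintro _ ⟨k, rfl⟩
    have h1 := hεs.sum_le_tsum (Finset.range k) fun i _ => hε i
    have h2 : 0 ≤ a k / c k := div_nonneg (ha k) (by linarith [hc1 k])
    simp only [hb]
    linarith
  have hlim := ((tendsto_atTop_ciInf hanti hbdd).add hεs.hasSum.tendsto_sum_nat).mul hC
  refine ⟨_, hlim.congr fun k => ?_⟩
  have := hc1 k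
  change (a k / c k - ∑ i ∈ Finset.range k, ε i + ∑ i ∈ Finset.range k, ε i) * c k = a k
  field_simp
  ring

variable {X : Type*} [NormedAddCommGroup X] [InnerProductSpace ℝ X] [CompleteSpace X]

/-- A bounded quasi-decreasing sequence of positive operators converges strongly. -/
theorem exists_tendsto_apply_of_quasi_decreasing {V : ℕ → X →L[ℝ] X} {η : ℕ → ℝ} {C : ℝ}
    (hC : 0 < C) (hV : ∀ k, (V k).IsPositive) (hVC : ∀ k w, ⟪V k w, w⟫_ℝ ≤ C * ‖w‖ ^ 2)
    (hη : ∀ k, 0 ≤ η k) (hηs : Summable η) (hstep : ∀ k, V (k + 1) ≤ (1 + η k) • V k) (w : X) :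
    ∃ v, Tendsto (fun k => V k w) atTop (𝓝 v) := by
  set c : ℕ → ℝ := fun k => ∏ i ∈ Finset.range k, (1 + η i) with hc
  obtain ⟨c', hc'⟩ := exists_tendsto_prod_one_add hη hηs
  have hc1 : ∀ k, 1 ≤ c k := one_le_prod_one_add hη
  have hcpos : ∀ k, 0 < c k := fun k => one_pos.trans_le (hc1 k)
  have hcs : ∀ k, c (k + 1) = c k * (1 + η k) := fun k => Finset.prod_range_succ _ _
  -- The rescaled operators decrease in the Loewner order, and `norm_sq_apply_le` turns convergence
  -- of their quadratic forms into the Cauchy property of `P k w`.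
  set P : ℕ → X →L[ℝ] X := fun k => (c k)⁻¹ • V k with hP
  have hPin : ∀ k u, ⟪P k u, u⟫_ℝ = (c k)⁻¹ * ⟪V k u, u⟫_ℝ := fun k u => by
    simp [hP, real_inner_smul_left]
  have hP0 : ∀ k u, 0 ≤ ⟪P k u, u⟫_ℝ := fun k u => by
    rw [hPin]
    exact mul_nonneg (inv_nonneg.2 (hcpos k).le) ((hV k).inner_nonneg_left u)
  have hanti : ∀ u, Antitone fun k => ⟪P k u, u⟫_ℝ := fun u => antitone_nat_of_succ_le fun k => by
    have h1 := inner_le_of_le (hstep k) u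
    rw [smul_apply, real_inner_smul_left] at h1
    have h2 := hcpos k
    have h3 := hη k
    rw [hPin, hPin, hcs, inv_mul_le_iff₀ (by positivity)]
    refine h1.trans_eq ?_
    field_simp
  have hdiff : ∀ m n, m ≤ n → ‖P m w - P n w‖ ^ 2 ≤ C * (⟪P m w, w⟫_ℝ - ⟪P n w, w⟫_ℝ) := by
    intro m n hmn
    have hD : (P m - P n).IsPositive := by
      refine isPositive_of_inner (fun x y => ?_) fun x => ?_
      · simp [hP, inner_sub_left, inner_sub_right, real_inner_smul_left, real_inner_smul_right,
          (hV _).inner_left_eq_inner_right]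
      · rw [sub_apply, inner_sub_left]
        exact sub_nonneg.2 (hanti x hmn)
    have := norm_sq_apply_le hD hC (fun x => ?_) w
    · simpa [inner_sub_left] using this
    · rw [sub_apply, inner_sub_left]
      have h1 := hP0 n x
      have h2 : ⟪P m x, x⟫_ℝ ≤ ⟪V m x, x⟫_ℝ := by
        rw [hPin, inv_mul_le_iff₀ (hcpos m)]
        exact le_mul_of_one_le_left ((hV m).inner_nonneg_left x) (hc1 m)
      linarith [hVC m x]
  have hlim := tendsto_atTop_ciInf (hanti w) ⟨0, by rintro _ ⟨k, rfl⟩; exact hP0 k w⟩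
  set p := ⨅ k, ⟪P k w, w⟫_ℝ
  have hcauchy : CauchySeq fun k => P k w := by
    refine cauchySeq_of_le_tendsto_0' (fun k => √(C * (⟪P k w, w⟫_ℝ - p))) (fun m n hmn => ?_) ?_
    · rw [dist_eq_norm]
      refine Real.le_sqrt_of_sq_le ((hdiff m n hmn).trans ?_)
      have := (hanti w).le_of_tendsto hlim n
      gcongr
    · simpa using ((hlim.sub_const p).const_mul C).sqrt
  obtain ⟨v, hv⟩ := cauchySeq_tendsto_of_complete hcauchy
  refine ⟨c' • v, (hc'.smul hv).congr fun k => ?_⟩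
  change c k • ((c k)⁻¹ • V k w) = V k w
  rw [smul_smul, mul_inv_cancel₀ (hcpos k).ne', one_smul]

/-- Along an ultrafilter every bounded family in a Hilbert space converges weakly. -/
theorem exists_weak_tendsto_ultrafilter {ι : Type*} (𝒰 : Ultrafilter ι) {x : ι → X} {C : ℝ}
    (hC : ∀ i, ‖x i‖ ≤ C) :
    ∃ z, ∀ u, Tendsto (fun i => ⟪x i, u⟫_ℝ) 𝒰 (𝓝 ⟪z, u⟫_ℝ) := by
  set F : ι → WeakDual ℝ X := fun i => StrongDual.toWeakDual (InnerProductSpace.toDual ℝ X (x i))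
  have hF : ∀ i, F i ∈ WeakDual.toStrongDual ⁻¹' Metric.closedBall (0 : StrongDual ℝ X) C :=
    fun i => by
      simp only [mem_preimage, mem_closedBall_zero_iff]
      exact ((InnerProductSpace.toDual ℝ X).norm_map (x i)).trans_le (hC i)
  -- Banach–Alaoglu in the dual, transported back by Riesz.
  obtain ⟨φ, -, hφ⟩ := (WeakDual.isCompact_closedBall (𝕜 := ℝ) (0 : StrongDual ℝ X) C).ultrafilter_le_nhds
    (𝒰.map F) (by
      rw [Ultrafilter.coe_map, le_principal_iff, mem_map]
      exact univ_mem' hF)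
  refine ⟨(InnerProductSpace.toDual ℝ X).symm (WeakDual.toStrongDual φ), fun u => ?_⟩
  rw [InnerProductSpace.toDual_symm_apply]
  exact ((WeakDual.eval_continuous u).tendsto φ).comp hφ

/-- Weak convergence of variable metric quasi-Fejér sequences all of whose weak cluster points lie
in the target set. -/
theorem exists_weaklyConvergesTo {S : Set X} {V : ℕ → X →L[ℝ] X} {x : ℕ → X} {η : ℕ → ℝ} {α C : ℝ}
    (hα : 0 < α) (hC : 0 < C) (hV : ∀ k, α • (1 : X →L[ℝ] X) ≤ V k)
    (hVC : ∀ k w, ⟪V k w, w⟫_ℝ ≤ C * ‖w‖ ^ 2)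
    (hη : ∀ k, 0 ≤ η k) (hηs : Summable η) (hstep : ∀ k, V (k + 1) ≤ (1 + η k) • V k)
    {R : ℝ} (hR : ∀ k, ‖x k‖ ≤ R)
    (hconv : ∀ z ∈ S, ∃ ℓ, Tendsto (fun k => ⟪V k (x k - z), x k - z⟫_ℝ) atTop (𝓝 ℓ))
    (hcl : ∀ (𝒰 : Ultrafilter ℕ) (z : X), (𝒰 : Filter ℕ) ≤ atTop →
      (∀ u, Tendsto (fun k => ⟪x k, u⟫_ℝ) 𝒰 (𝓝 ⟪z, u⟫_ℝ)) → z ∈ S) :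
    ∃ z ∈ S, WeaklyConvergesTo x z := by
  have hpos : ∀ k, (V k).IsPositive := fun k => isPositive_of_smul_one_le hα.le (hV k)
  have huniq : ∀ (𝒰 𝒲 : Ultrafilter ℕ) (z w : X), (𝒰 : Filter ℕ) ≤ atTop →
      (𝒲 : Filter ℕ) ≤ atTop → (∀ u, Tendsto (fun k => ⟪x k, u⟫_ℝ) 𝒰 (𝓝 ⟪z, u⟫_ℝ)) →
      (∀ u, Tendsto (fun k => ⟪x k, u⟫_ℝ) 𝒲 (𝓝 ⟪w, u⟫_ℝ)) → z = w := by
    intro 𝒰 𝒲 z w h𝒰 h𝒲 hz hw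
    obtain ⟨a, ha⟩ := hconv z (hcl 𝒰 z h𝒰 hz)
    obtain ⟨b, hb⟩ := hconv w (hcl 𝒲 w h𝒲 hw)
    have hst := fun u => exists_tendsto_apply_of_quasi_decreasing hC hpos hVC hη hηs hstep u
    obtain ⟨v, hv⟩ := hst (z - w)
    obtain ⟨vz, hvz⟩ := hst z
    obtain ⟨vw, hvw⟩ := hst w
    have hzz : Tendsto (fun k => ⟪V k z, z⟫_ℝ) atTop (𝓝 ⟪vz, z⟫_ℝ) :=
      Filter.Tendsto.inner (𝕜 := ℝ) hvz tendsto_const_nhds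
    have hww : Tendsto (fun k => ⟪V k w, w⟫_ℝ) atTop (𝓝 ⟪vw, w⟫_ℝ) :=
      Filter.Tendsto.inner (𝕜 := ℝ) hvw tendsto_const_nhds
    -- Polarization: `2⟨x, V(z - w)⟩ = ‖x - w‖² - ‖x - z‖² + ‖z‖² - ‖w‖²` in the metric `V k`. One
    -- limit along both ultrafilters then forces `⟨v, z - w⟩ = 0`.
    obtain ⟨ℓ, hℓ⟩ : ∃ ℓ, Tendsto (fun k => ⟪x k, V k (z - w)⟫_ℝ) atTop (𝓝 ℓ) := by
      refine ⟨_, (((hb.sub ha).add (hzz.sub hww)).const_mul (1 / 2)).congr fun k => ?_⟩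
      have e : ∀ u, ⟪V k u, x k⟫_ℝ = ⟪V k (x k), u⟫_ℝ := fun u => by
        rw [(hpos k).inner_left_eq_inner_right, real_inner_comm]
      rw [← (hpos k).inner_left_eq_inner_right]
      simp only [map_sub, inner_sub_left, inner_sub_right, e]
      ring
    have h1 := tendsto_nhds_unique (tendsto_inner_of_weak hR hz (hv.mono_left h𝒰))
      (hℓ.mono_left h𝒰)
    have h2 := tendsto_nhds_unique (tendsto_inner_of_weak hR hw (hv.mono_left h𝒲))
      (hℓ.mono_left h𝒲)
    have h3 : ⟪v, z - w⟫_ℝ = 0 := by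
      rw [real_inner_comm, inner_sub_left, h1, h2, sub_self]
    have h4 : Tendsto (fun k => ⟪V k (z - w), z - w⟫_ℝ) atTop (𝓝 ⟪v, z - w⟫_ℝ) :=
      Filter.Tendsto.inner (𝕜 := ℝ) hv tendsto_const_nhds
    have h5 := ge_of_tendsto' h4 fun k => mul_norm_sq_le_of_smul_one_le (hV k) (z - w)
    rw [h3] at h5
    have h6 : ‖z - w‖ ^ 2 ≤ 0 := nonpos_of_mul_nonpos_right h5 hα
    exact sub_eq_zero.1 (norm_eq_zero.1 (pow_eq_zero_iff two_ne_zero |>.1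
      (le_antisymm h6 (sq_nonneg _))))
  obtain ⟨z, hz⟩ := exists_weak_tendsto_ultrafilter (Ultrafilter.of (atTop : Filter ℕ)) hR
  refine ⟨z, hcl _ z (Ultrafilter.of_le _) hz, fun u => ?_⟩
  rw [tendsto_iff_ultrafilter]
  intro 𝒲 h𝒲
  obtain ⟨w, hw⟩ := exists_weak_tendsto_ultrafilter 𝒲 hR
  rw [huniq _ 𝒲 z w (Ultrafilter.of_le _) h𝒲 hz hw]
  exact hw u

end QuasiFejer

/-! ### Energy and stability estimates for one forward–backward step. -/

section ForwardBackward

variable {X : Type*} [NormedAddCommGroup X] [InnerProductSpace ℝ X]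

theorem smul_one_le_smul_one {a b : ℝ} (h : a ≤ b) :
    a • (1 : X →L[ℝ] X) ≤ b • (1 : X →L[ℝ] X) := by
  refine le_of_inner_le ?_ ?_ fun x => ?_
  · simp [real_inner_smul_left, real_inner_smul_right]
  · simp [real_inner_smul_left, real_inner_smul_right]
  · simp only [smul_apply, one_apply_eq_self, real_inner_smul_left]
    exact mul_le_mul_of_nonneg_right h real_inner_self_nonneg

theorem inner_mul_symm {U Λ : X →L[ℝ] X} {νU νΛ : ℝ} (hU : νU • (1 : X →L[ℝ] X) ≤ U)
    (hΛ : νΛ • (1 : X →L[ℝ] X) ≤ Λ) (hc : Λ * U = U * Λ) (x y : X) :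
    ⟪(Λ * U) x, y⟫_ℝ = ⟪x, (Λ * U) y⟫_ℝ := by
  conv_rhs => rw [hc]
  simp only [mul_apply_eq_comp]
  rw [inner_symm_of_smul_one_le hΛ, inner_symm_of_smul_one_le hU]

/-- Positivity of the commuting product `U (Λ - νΛ)` gives `ΛU ≥ νΛ U`. -/
theorem smul_one_le_mul {U Λ : X →L[ℝ] X} {νU νΛ : ℝ} (hνU : 0 ≤ νU) (hνΛ : 0 ≤ νΛ)
    (hU : νU • (1 : X →L[ℝ] X) ≤ U) (hΛ : νΛ • (1 : X →L[ℝ] X) ≤ Λ) (hΛ1 : Λ ≤ 1)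
    (hc : Λ * U = U * Λ) : (νΛ * νU) • (1 : X →L[ℝ] X) ≤ Λ * U := by
  refine le_of_inner_le (by simp [real_inner_smul_left, real_inner_smul_right])
    (inner_mul_symm hU hΛ hc) fun x => ?_
  have hT : (Λ - νΛ • (1 : X →L[ℝ] X)).IsPositive := (ContinuousLinearMap.le_def _ _).1 hΛ
  have hT1 : (1 - (Λ - νΛ • (1 : X →L[ℝ] X))).IsPositive := by
    rw [sub_sub_eq_add_sub, add_sub_right_comm]
    exact ((ContinuousLinearMap.le_def _ _).1 hΛ1).add
      (ContinuousLinearMap.isPositive_one.smul_of_nonneg hνΛ)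
  have hcomm : Commute U (Λ - νΛ • (1 : X →L[ℝ] X)) :=
    Commute.sub_right hc.symm ((Commute.one_right U).smul_right νΛ)
  have h1 := inner_mul_nonneg (isPositive_of_smul_one_le hνU hU) hT hT1 hcomm x
  have h2 := mul_le_mul_of_nonneg_left (mul_norm_sq_le_of_smul_one_le hU x) hνΛ
  rw [hc]
  simp only [sub_apply, smul_apply, one_apply_eq_self, map_sub, map_smul, inner_sub_left,
    real_inner_smul_left, mul_apply_eq_comp, real_inner_self_eq_norm_sq] at h1 ⊢
  linarith

theorem mul_le_smul_one {U Λ : X →L[ℝ] X} {νU νΛ μU : ℝ} (hνU : 0 ≤ νU) (hνΛ : 0 ≤ νΛ)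
    (hU : νU • (1 : X →L[ℝ] X) ≤ U) (hUμ : U ≤ μU • (1 : X →L[ℝ] X))
    (hΛ : νΛ • (1 : X →L[ℝ] X) ≤ Λ) (hΛ1 : Λ ≤ 1) (hc : Λ * U = U * Λ) :
    Λ * U ≤ μU • (1 : X →L[ℝ] X) := by
  refine le_of_inner_le (inner_mul_symm hU hΛ hc)
    (by simp [real_inner_smul_left, real_inner_smul_right]) fun x => ?_
  have h1 := inner_mul_nonneg (isPositive_of_smul_one_le hνU hU)
    ((ContinuousLinearMap.le_def _ _).1 hΛ1)
    (by rw [sub_sub_cancel]; exact isPositive_of_smul_one_le hνΛ hΛ)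
    (Commute.sub_right (Commute.one_right U) hc.symm) x
  have h2 := inner_le_of_le_smul_one hUμ x
  rw [hc]
  simp only [sub_apply, smul_apply, one_apply_eq_self, map_sub, inner_sub_left,
    real_inner_smul_left, mul_apply_eq_comp, real_inner_self_eq_norm_sq] at h1 ⊢
  linarith

/-- The energy decrease of one forward–backward step, for `a = x - q`, `b = x - z` and
`δ = ∇f x - ∇f z`. -/
theorem forward_backward_decrease {W : X →L[ℝ] X} {μ β ε γ : ℝ} {a b δ : X} (hμ : 0 < μ)
    (hε : 0 < ε) (hεβ : ε < 2 * β) (hW : μ⁻¹ • (1 : X →L[ℝ] X) ≤ W) (hγ : ε ≤ γ)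
    (hγμ : γ * μ ≤ 2 * β - ε) (hmono : γ * ⟪δ, b - a⟫_ℝ ≤ ⟪W a, b - a⟫_ℝ)
    (hcoc : β * ‖δ‖ ^ 2 ≤ ⟪δ, b⟫_ℝ) :
    ⟪W (b - a), b - a⟫_ℝ + (ε / 2 / (μ * (2 * β - ε / 2)) * ‖a‖ ^ 2 + ε ^ 2 / 2 * ‖δ‖ ^ 2)
      ≤ ⟪W b, b⟫_ℝ := by
  have hγ0 : 0 < γ := hε.trans_le hγ
  -- Young's weight halves the slack `ε`: `κ < 2β` leaves a multiple of `‖δ‖²`, and `γμ ≤ κ - ε / 2`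
  -- leaves a multiple of `‖a‖²`.
  set κ := 2 * β - ε / 2 with hκ
  have hκ0 : 0 < κ := by linarith
  have h1 := mul_norm_sq_le_of_smul_one_le hW a
  have h2 := real_inner_le_norm δ a
  have hs : ⟪W b, a⟫_ℝ = ⟪W a, b⟫_ℝ := by rw [inner_symm_of_smul_one_le hW, real_inner_comm]
  simp only [map_sub, inner_sub_left, inner_sub_right, hs] at hmono ⊢
  have h3 : 2 * (‖δ‖ * ‖a‖) ≤ κ * ‖δ‖ ^ 2 + κ⁻¹ * ‖a‖ ^ 2 := by
    have : 0 ≤ κ * (‖δ‖ - κ⁻¹ * ‖a‖) ^ 2 := by positivity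
    have e : κ * (‖δ‖ - κ⁻¹ * ‖a‖) ^ 2
        = κ * ‖δ‖ ^ 2 + κ⁻¹ * ‖a‖ ^ 2 - 2 * (‖δ‖ * ‖a‖) := by field_simp; ring
    linarith
  have h4 : γ * (2 * ⟪δ, a⟫_ℝ) ≤ γ * (κ * ‖δ‖ ^ 2 + κ⁻¹ * ‖a‖ ^ 2) := by
    gcongr; linarith
  have h5 : γ * (β * ‖δ‖ ^ 2) ≤ γ * ⟪δ, b⟫_ℝ := by gcongr
  have h6 : (γ * κ⁻¹ + ε / 2 / (μ * κ)) * ‖a‖ ^ 2 ≤ μ⁻¹ * ‖a‖ ^ 2 := by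
    gcongr
    have e : γ * κ⁻¹ + ε / 2 / (μ * κ) = (γ * μ + ε / 2) / (μ * κ) := by field_simp
    rw [e, div_le_iff₀ (by positivity), ← mul_assoc, inv_mul_cancel₀ hμ.ne', one_mul]
    linarith
  have h7 : ε * (ε / 2 * ‖δ‖ ^ 2) ≤ γ * (ε / 2 * ‖δ‖ ^ 2) := by gcongr
  have h8 : γ * (κ * ‖δ‖ ^ 2) = 2 * (γ * (β * ‖δ‖ ^ 2)) - γ * (ε / 2 * ‖δ‖ ^ 2) := by
    rw [hκ]; ring
  nlinarith

variable [CompleteSpace X]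

/-- Averaging with the operator `Λ` transfers the energy estimate from the metric `U⁻¹` to the
metric `(Λ U)⁻¹`. -/
theorem inner_relaxed_le {U Λ : X →L[ℝ] X} {νU νΛ : ℝ} (hνU : 0 < νU) (hνΛ : 0 < νΛ)
    (hU : νU • (1 : X →L[ℝ] X) ≤ U) (hΛ : νΛ • (1 : X →L[ℝ] X) ≤ Λ) (hΛ1 : Λ ≤ 1)
    (hc : Λ * U = U * Λ) (b d : X) :
    ⟪Ring.inverse (Λ * U) (b + Λ d), b + Λ d⟫_ℝ + ⟪Ring.inverse U b, b⟫_ℝ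
      ≤ ⟪Ring.inverse (Λ * U) b, b⟫_ℝ + ⟪Ring.inverse U (b + d), b + d⟫_ℝ := by
  have hUu := isUnit_of_smul_one_le hνU hU
  have hΛU := isUnit_of_smul_one_le (mul_pos hνΛ hνU) (smul_one_le_mul hνU.le hνΛ.le hU hΛ hΛ1 hc)
  have hWs := inner_inverse_symm hUu (inner_symm_of_smul_one_le hU)
  have hVs := inner_inverse_symm hΛU (inner_mul_symm hU hΛ hc)
  have hUpos := isPositive_of_smul_one_le hνU.le hU
  -- This makes the cross terms of both expansions equal; what remains is the form of `U (1 - Λ) ≥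
  -- 0` at `U⁻¹ d`.
  have e1 : Ring.inverse (Λ * U) (Λ d) = Ring.inverse U d := by
    rw [← inverse_apply_apply hΛU (Ring.inverse U d), mul_apply_eq_comp,
      apply_inverse_apply hUu]
  have e2 : ⟪Ring.inverse (Λ * U) b, Λ d⟫_ℝ = ⟪Ring.inverse U d, b⟫_ℝ := by
    rw [hVs, e1, real_inner_comm]
  have e3 : ⟪Ring.inverse U b, d⟫_ℝ = ⟪Ring.inverse U d, b⟫_ℝ := by
    rw [hWs, real_inner_comm]
  have h1 := inner_mul_nonneg hUpos ((ContinuousLinearMap.le_def _ _).1 hΛ1)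
    (by rw [sub_sub_cancel]; exact isPositive_of_smul_one_le hνΛ.le hΛ)
    (Commute.sub_right (Commute.one_right U) hc.symm) (Ring.inverse U d)
  have e4 : ⟪U ((1 - Λ) (Ring.inverse U d)), Ring.inverse U d⟫_ℝ
      = ⟪Ring.inverse U d, d⟫_ℝ - ⟪Ring.inverse U d, Λ d⟫_ℝ := by
    rw [hUpos.inner_left_eq_inner_right, apply_inverse_apply hUu, sub_apply, one_apply_eq_self,
      inner_sub_left, inner_symm_of_smul_one_le hΛ]
  rw [e4] at h1
  simp only [map_add, inner_add_left, inner_add_right, e1, e2, e3]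
  linarith

/-- The exact forward–backward point `prox_{γ g}^{U⁻¹} (x - γ U ∇f x)`. -/
noncomputable def fbPoint (f : X → ℝ) (g : X → EReal) (U : X →L[ℝ] X) (γ : ℝ) (x : X) : X :=
  prox (Ring.inverse U) γ g (x - γ • U (gradient f x))

theorem isSubgradient_fbPoint {f : X → ℝ} {g : X → EReal} (hg : IsGammaZero g) {U : X →L[ℝ] X}
    {νU μU γ : ℝ} (hνU : 0 < νU) (hμU : 0 < μU) (hU : νU • (1 : X →L[ℝ] X) ≤ U)
    (hUμ : U ≤ μU • (1 : X →L[ℝ] X)) (hγ : 0 < γ) (x : X) :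
    IsSubgradient g (fbPoint f g U γ x)
      (γ⁻¹ • Ring.inverse U (x - fbPoint f g U γ x) - gradient f x) := by
  have h := isSubgradient_prox hg (inv_pos.2 hμU) (inv_smul_one_le_inverse hνU hU hμU hUμ) hγ
    (x - γ • U (gradient f x))
  change IsSubgradient g (fbPoint f g U γ x)
    (γ⁻¹ • Ring.inverse U (x - γ • U (gradient f x) - fbPoint f g U γ x)) at h
  rwa [sub_right_comm, map_sub (Ring.inverse U), map_smul,
    inverse_apply_apply (isUnit_of_smul_one_le hνU hU), smul_sub, smul_smul,
    inv_mul_cancel₀ hγ.ne', one_smul] at h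

/-- Stability of the backward step under an error in the gradient. -/
theorem norm_prox_sub_fbPoint_le {f : X → ℝ} {g : X → EReal} (hg : IsGammaZero g) {U : X →L[ℝ] X}
    {νU μU γ : ℝ} (hνU : 0 < νU) (hμU : 0 < μU) (hU : νU • (1 : X →L[ℝ] X) ≤ U)
    (hUμ : U ≤ μU • (1 : X →L[ℝ] X)) (hγ : 0 < γ) (x b : X) :
    ‖prox (Ring.inverse U) γ g (x - γ • U (gradient f x + b)) - fbPoint f g U γ x‖
      ≤ γ * μU * ‖b‖ := by
  have hW := inv_smul_one_le_inverse hνU hU hμU hUμ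
  have h1 := isSubgradient_prox hg (inv_pos.2 hμU) hW hγ (x - γ • U (gradient f x + b))
  have h2 := isSubgradient_prox hg (inv_pos.2 hμU) hW hγ (x - γ • U (gradient f x))
  have h3 := h1.monotone h2
  change _ ≤ ⟪_, _ - fbPoint f g U γ x⟫_ℝ at h3
  change _ ≤ ⟪_ - γ⁻¹ • Ring.inverse U (_ - fbPoint f g U γ x), _⟫_ℝ at h3
  set p := prox (Ring.inverse U) γ g (x - γ • U (gradient f x + b))
  set q := fbPoint f g U γ x
  -- Monotonicity at `p` and `q` then bounds `γ⁻¹‖p - q‖²` in the metric `U⁻¹` by `-⟨b, p - q⟩`.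
  have e : γ⁻¹ • Ring.inverse U (x - γ • U (gradient f x + b) - p)
      - γ⁻¹ • Ring.inverse U (x - γ • U (gradient f x) - q)
      = -(b + γ⁻¹ • Ring.inverse U (p - q)) := by
    rw [← smul_sub, ← map_sub, show x - γ • U (gradient f x + b) - p
      - (x - γ • U (gradient f x) - q) = -(γ • U b) - (p - q) by rw [map_add]; module,
      map_sub, map_neg, map_smul, inverse_apply_apply (isUnit_of_smul_one_le hνU hU), smul_sub,
      smul_neg, smul_smul, inv_mul_cancel₀ hγ.ne', one_smul]
    abel
  rw [e, inner_neg_left, inner_add_left, real_inner_smul_left] at h3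
  have h4 := mul_norm_sq_le_of_smul_one_le hW (p - q)
  have h5 : -⟪b, p - q⟫_ℝ ≤ ‖b‖ * ‖p - q‖ := (neg_le_abs _).trans (abs_real_inner_le_norm _ _)
  have h6 : γ⁻¹ * (μU⁻¹ * ‖p - q‖ ^ 2) ≤ ‖b‖ * ‖p - q‖ :=
    (mul_le_mul_of_nonneg_left h4 (inv_nonneg.2 hγ.le)).trans (by linarith)
  rw [inv_mul_le_iff₀ hγ, inv_mul_le_iff₀ hμU] at h6
  rcases (norm_nonneg (p - q)).eq_or_lt with h0 | h0
  · rw [← h0]; positivity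
  · refine le_of_mul_le_mul_right ?_ h0
    nlinarith

end ForwardBackward

/-! ### The relaxed energy estimate and the convergence theorem. -/

section Main

variable {X : Type*} [NormedAddCommGroup X] [InnerProductSpace ℝ X]

/-- The natural factor `√(1 + η)` is relaxed so that one sequence serves both operators and norms.
-/
theorem metricNorm_succ_le {V V' : X →L[ℝ] X} {η : ℝ} (hη : 0 ≤ η) (h : V' ≤ (1 + η) • V)
    (w : X) : metricNorm V' w ≤ (1 + η) * metricNorm V w := by
  have h1 := inner_le_of_le h w
  rw [smul_apply, real_inner_smul_left] at h1
  calc metricNorm V' w ≤ √((1 + η) * ⟪V w, w⟫_ℝ) := Real.sqrt_le_sqrt h1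
    _ = √(1 + η) * metricNorm V w := Real.sqrt_mul (by linarith) _
    _ ≤ (1 + η) * metricNorm V w := by
      refine mul_le_mul_of_nonneg_right ?_ (metricNorm_nonneg _ _)
      refine (Real.sqrt_le_sqrt (by nlinarith : 1 + η ≤ (1 + η) ^ 2)).trans_eq ?_
      exact Real.sqrt_sq (by linarith)

variable [CompleteSpace X]

/-- The energy estimate for one exact relaxed forward–backward step. -/
theorem relaxed_forward_backward_decrease {f : X → ℝ} {g : X → EReal} {β : ℝ} (hg : IsGammaZero g)
    (hβ : 0 < β) (hf : ConvexOn ℝ univ f) (hd : Differentiable ℝ f)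
    (hL : ∀ x y : X, ‖gradient f x - gradient f y‖ ≤ 1 / β * ‖x - y‖)
    {U Λ : X →L[ℝ] X} {νU μU νΛ ε γ : ℝ} (hνU : 0 < νU) (hμU : 0 < μU) (hνΛ : 0 < νΛ)
    (hU : νU • (1 : X →L[ℝ] X) ≤ U) (hUμ : U ≤ μU • (1 : X →L[ℝ] X))
    (hΛ : νΛ • (1 : X →L[ℝ] X) ≤ Λ) (hΛ1 : Λ ≤ 1) (hc : Λ * U = U * Λ)
    (hε : 0 < ε) (hεβ : ε < 2 * β) (hγ : ε ≤ γ) (hγμ : γ * μU ≤ 2 * β - ε)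
    {z : X} (hz : z ∈ Argmin fun z => (f z : EReal) + g z) (x : X) :
    ⟪Ring.inverse (Λ * U) (x - z + Λ (fbPoint f g U γ x - x)),
        x - z + Λ (fbPoint f g U γ x - x)⟫_ℝ
      + (ε / 2 / (μU * (2 * β - ε / 2)) * ‖x - fbPoint f g U γ x‖ ^ 2
        + ε ^ 2 / 2 * ‖gradient f x - gradient f z‖ ^ 2)
      ≤ ⟪Ring.inverse (Λ * U) (x - z), x - z⟫_ℝ := by
  have hγ0 : 0 < γ := hε.trans_le hγ
  have h1 := inner_relaxed_le hνU hνΛ hU hΛ hΛ1 hc (x - z) (fbPoint f g U γ x - x)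
  have hq := isSubgradient_fbPoint (f := f) hg hνU hμU hU hUμ hγ0 x
  have hsz := isSubgradient_of_argmin hg (hd z).hasGradientAt hz
  have hm := hq.monotone hsz
  set q := fbPoint f g U γ x
  have hmono : γ * ⟪gradient f x - gradient f z, (x - z) - (x - q)⟫_ℝ
      ≤ ⟪Ring.inverse U (x - q), (x - z) - (x - q)⟫_ℝ := by
    rw [show (x - z) - (x - q) = q - z by abel]
    rw [show γ⁻¹ • Ring.inverse U (x - q) - gradient f x - -gradient f z
      = γ⁻¹ • Ring.inverse U (x - q) - (gradient f x - gradient f z) by abel, inner_sub_left,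
      real_inner_smul_left, sub_nonneg, le_inv_mul_iff₀ hγ0] at hm
    exact hm
  have h2 := forward_backward_decrease hμU hε hεβ (inv_smul_one_le_inverse hνU hU hμU hUμ) hγ hγμ
    hmono (gradient_cocoercive hf hd hβ hL x z)
  rw [show (x - z) - (x - q) = x - z + (q - x) by abel] at h2
  linarith

end Main

end OperatorAveraged

open OperatorAveraged in
theorem theorem2 {X : Type*} [NormedAddCommGroup X] [InnerProductSpace ℝ X] [CompleteSpace X]
    (f : X → ℝ) (g : X → EReal) (β : ℝ)
    (hg : OperatorAveraged.IsGammaZero g)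
    (hβ : 0 < β)
    (hf_convex : ConvexOn ℝ Set.univ f)
    (hf_diff : Differentiable ℝ f)
    (hf_lip : ∀ x y : X, ‖gradient f x - gradient f y‖ ≤ 1 / β * ‖x - y‖)
    (U : ℕ → X →L[ℝ] X) (μU νU : ℝ)
    (hμU : 0 < μU) (hνU : 0 < νU)
    (hU : ∀ k, νU • (1 : X →L[ℝ] X) ≤ U k ∧ U k ≤ μU • (1 : X →L[ℝ] X))
    (ε : ℝ) (hε : ε ∈ Set.Ioo 0 (min 1 (2 * β / (μU + 1))))
    (Λ : ℕ → X →L[ℝ] X) (μΛ νΛ : ℝ)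
    (hμΛ : μΛ ∈ Set.Icc ε 1) (hνΛ : νΛ ∈ Set.Icc ε 1)
    (hcomm : ∀ k, Λ k * U k = U k * Λ k)
    (hΛ : ∀ k, νΛ • (1 : X →L[ℝ] X) ≤ Λ k ∧ Λ k ≤ μΛ • (1 : X →L[ℝ] X))
    (η : ℕ → ℝ) (hη_nonneg : ∀ k, 0 ≤ η k) (hη_summable : Summable η)
    (hmono : ∀ k, Λ k * U k ≤ (1 + η k) • (Λ (k + 1) * U (k + 1)))
    (γ : ℕ → ℝ) (hγ : ∀ k, γ k ∈ Set.Icc ε ((2 * β - ε) / μU))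
    (a b : ℕ → X) (ha : Summable fun k => ‖a k‖) (hb : Summable fun k => ‖b k‖)
    (hZ : (OperatorAveraged.Argmin fun z => (f z : EReal) + g z).Nonempty)
    (x : ℕ → X) (hx : OperatorAveraged.IsGenerated f g U Λ γ a b x) :
    OperatorAveraged.QuasiFejerMonotone
        (OperatorAveraged.Argmin fun z => (f z : EReal) + g z)
        (fun k => Ring.inverse (Λ k * U k)) x ∧
      ∃ z ∈ OperatorAveraged.Argmin (fun z => (f z : EReal) + g z),
        OperatorAveraged.WeaklyConvergesTo x z := by
  have hε0 : 0 < ε := hε.1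
  have hεβ : ε < 2 * β := by
    refine (hε.2.trans_le (min_le_right _ _)).trans_le ?_
    exact div_le_self (by positivity) (by linarith)
  have hνΛ0 : 0 < νΛ := hε0.trans_le hνΛ.1
  have hγ0 : ∀ k, 0 < γ k := fun k => hε0.trans_le (hγ k).1
  have hγμ : ∀ k, γ k * μU ≤ 2 * β - ε := fun k => (le_div_iff₀ hμU).1 (hγ k).2
  have hΛ1 : ∀ k, Λ k ≤ 1 := fun k => by
    simpa using (hΛ k).2.trans (smul_one_le_smul_one hμΛ.2)
  set m := νΛ * νU with hm
  have hm0 : 0 < m := mul_pos hνΛ0 hνU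
  have hlow : ∀ k, m • (1 : X →L[ℝ] X) ≤ Λ k * U k := fun k =>
    smul_one_le_mul hνU.le hνΛ0.le (hU k).1 (hΛ k).1 (hΛ1 k) (hcomm k)
  have hupp : ∀ k, Λ k * U k ≤ μU • (1 : X →L[ℝ] X) := fun k =>
    mul_le_smul_one hνU.le hνΛ0.le (hU k).1 (hU k).2 (hΛ k).1 (hΛ1 k) (hcomm k)
  set V : ℕ → X →L[ℝ] X := fun k => Ring.inverse (Λ k * U k) with hVdef
  have hα : 0 < μU⁻¹ := inv_pos.2 hμU
  have hVlow : ∀ k, μU⁻¹ • (1 : X →L[ℝ] X) ≤ V k := fun k =>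
    inv_smul_one_le_inverse hm0 (hlow k) hμU (hupp k)
  have hVnorm : ∀ k, ‖V k‖ ≤ m⁻¹ := fun k => norm_inverse_le hm0 (hlow k)
  have hVupp : ∀ k w, ⟪V k w, w⟫_ℝ ≤ m⁻¹ * ‖w‖ ^ 2 := fun k w => by
    have h1 := (V k).le_of_opNorm_le (hVnorm k) w
    have h2 := mul_le_mul_of_nonneg_right h1 (norm_nonneg w)
    linarith [real_inner_le_norm (V k w) w]
  have hunit : ∀ k, IsUnit (Λ k * U k) := fun k => isUnit_of_smul_one_le hm0 (hlow k)
  have hVstep : ∀ k, V (k + 1) ≤ (1 + η k) • V k := fun k => by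
    have hη1 : 0 < 1 + η k := by linarith [hη_nonneg k]
    have hsV := fun k => inner_symm_of_smul_one_le (hVlow k)
    refine le_of_inner_le (hsV _) (fun x y => ?_) fun w => ?_
    · simp [real_inner_smul_left, real_inner_smul_right, hsV]
    · have h1 := inner_inverse_le (hunit k)
        ((hunit (k + 1)).smul (Units.mk0 _ hη1.ne') : IsUnit ((1 + η k) • _))
        (isPositive_of_smul_one_le hm0.le (hlow k)) (inner_le_of_le (hmono k)) w
      rw [inverse_smul (hunit (k + 1)) hη1.ne', smul_apply, real_inner_smul_left,
        inv_mul_le_iff₀ hη1] at h1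
      rwa [smul_apply, real_inner_smul_left]
  obtain ⟨y, hy⟩ := hx
  set q : ℕ → X := fun k => fbPoint f g (U k) (γ k) (x k) with hq
  set e : ℕ → X := fun k => prox (Ring.inverse (U k)) (γ k) g (y k) - q k + a k with he
  -- The factor `2 * β` bounds `γ k * μU`, the stability constant of the backward step.
  set t : ℕ → ℝ := fun k => 2 * β * ‖b k‖ + ‖a k‖ with ht
  have ht0 : ∀ k, 0 ≤ t k := fun k => by positivity
  have hts : Summable t := (hb.mul_left _).add ha
  have het : ∀ k, ‖e k‖ ≤ t k := fun k => by
    refine (norm_add_le _ _).trans (add_le_add ?_ le_rfl)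
    rw [(hy k).1]
    refine (norm_prox_sub_fbPoint_le hg hνU hμU (hU k).1 (hU k).2 (hγ0 k) (x k) (b k)).trans ?_
    exact mul_le_mul_of_nonneg_right (by linarith [hγμ k]) (norm_nonneg _)
  have hxs : ∀ k z, x (k + 1) - z = (x k - z + Λ k (q k - x k)) + Λ k (e k) := fun k z => by
    rw [(hy k).2, show prox (Ring.inverse (U k)) (γ k) g (y k) + a k - x k
      = (q k - x k) + e k by simp only [he]; abel, map_add]
    abel
  set D := √m⁻¹ with hD
  have hD0 : 0 ≤ D := Real.sqrt_nonneg _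
  have hDsq : D ^ 2 = m⁻¹ := Real.sq_sqrt (inv_nonneg.2 hm0.le)
  have hΛe : ∀ k, metricNorm (V k) (Λ k (e k)) ≤ D * t k := fun k => by
    have h1 : ‖Λ k (e k)‖ ≤ 1 * ‖e k‖ :=
      norm_apply_le_of_isPositive (isPositive_of_smul_one_le hνΛ0.le (hΛ k).1) one_pos
        (fun w => inner_le_of_le_smul_one (by simpa using hΛ1 k) w) _
    refine (metricNorm_le_of_inner_le (by rw [hDsq]; exact hVupp k _) hD0).trans ?_
    have := het k
    gcongr
    linarith
  set σ : X → ℕ → ℝ := fun z k => metricNorm (V k) (x k - z + Λ k (q k - x k)) with hσ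
  set c₁ := ε / 2 / (μU * (2 * β - ε / 2)) with hc₁
  have hc₁0 : 0 < c₁ := by
    have : 0 < 2 * β - ε / 2 := by linarith
    positivity
  have hdec : ∀ z ∈ Argmin (fun z => (f z : EReal) + g z), ∀ k, σ z k ^ 2
      + (c₁ * ‖x k - q k‖ ^ 2 + ε ^ 2 / 2 * ‖gradient f (x k) - gradient f z‖ ^ 2)
      ≤ metricNorm (V k) (x k - z) ^ 2 := fun z hz k => by
    simp only [hσ]
    rw [metricNorm_sq hα (hVlow k), metricNorm_sq hα (hVlow k)]
    exact relaxed_forward_backward_decrease hg hβ hf_convex hf_diff hf_lip hνU hμU hνΛ0 (hU k).1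
      (hU k).2 (hΛ k).1 (hΛ1 k) (hcomm k) hε0 hεβ (hγ k).1 (hγμ k) hz (x k)
  have hσle : ∀ z ∈ Argmin (fun z => (f z : EReal) + g z), ∀ k,
      σ z k ≤ metricNorm (V k) (x k - z) := fun z hz k => by
    refine le_of_sq_le_sq (le_trans ?_ (hdec z hz k)) (metricNorm_nonneg _ _)
    exact le_add_of_nonneg_right (by positivity)
  have hnext : ∀ z k, metricNorm (V (k + 1)) (x (k + 1) - z) ≤ (1 + η k) * (σ z k + D * t k) :=
    fun z k => by
    refine (metricNorm_succ_le (hη_nonneg k) (hVstep k) _).trans ?_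
    refine mul_le_mul_of_nonneg_left ?_ (by linarith [hη_nonneg k])
    rw [hxs k z]
    exact (metricNorm_add_le hα (hVlow k) _ _).trans (add_le_add le_rfl (hΛe k))
  -- A uniform bound on `1 + η k`, so that the error terms stay summable after the change of metric.
  set B := 1 + ∑' i, η i with hB
  have hηB : ∀ k, 1 + η k ≤ B := fun k => by
    have := hη_summable.le_tsum k fun j _ => hη_nonneg j
    linarith
  have hB0 : 0 ≤ B := by linarith [hηB 0, hη_nonneg 0]
  set ε' : ℕ → ℝ := fun k => B * (D * t k) with hε'
  have hε'0 : ∀ k, 0 ≤ ε' k := fun k => mul_nonneg hB0 (mul_nonneg hD0 (ht0 k))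
  have hε's : Summable ε' := (hts.mul_left D).mul_left B
  have hfejer : ∀ z ∈ Argmin (fun z => (f z : EReal) + g z), ∀ k,
      metricNorm (V (k + 1)) (x (k + 1) - z)
        ≤ (1 + η k) * metricNorm (V k) (x k - z) + ε' k := fun z hz k => by
    refine (hnext z k).trans ?_
    rw [mul_add]
    have h1 := hη_nonneg k
    exact add_le_add (mul_le_mul_of_nonneg_left (hσle z hz k) (by linarith))
      (mul_le_mul_of_nonneg_right (hηB k) (mul_nonneg hD0 (ht0 k)))
  refine ⟨⟨hZ, isClosed_argmin hg hf_diff.continuous, convex_argmin hg hf_convex,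
    ⟨μU⁻¹, hα, hVlow⟩, ⟨m⁻¹, by rintro _ ⟨k, rfl⟩; exact hVnorm k⟩, η, ε', hη_nonneg, hη_summable,
    hε'0, hε's, hVstep, hfejer⟩, ?_⟩
  have hlim : ∀ z ∈ Argmin (fun z => (f z : EReal) + g z), ∃ ℓ,
      Tendsto (fun k => metricNorm (V k) (x k - z)) atTop (𝓝 ℓ) := fun z hz =>
    exists_tendsto_of_quasi_decreasing (fun k => metricNorm_nonneg _ _) hη_nonneg hη_summable
      hε'0 hε's (hfejer z hz)
  obtain ⟨z₀, hz₀⟩ := hZ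
  obtain ⟨ℓ, hℓ⟩ := hlim z₀ hz₀
  obtain ⟨R, hR⟩ : ∃ R, ∀ k, ‖x k‖ ≤ R := by
    obtain ⟨M, hM⟩ := hℓ.bddAbove_range
    refine ⟨√(μU * M ^ 2) + ‖z₀‖, fun k => ?_⟩
    have h1 := mul_norm_sq_le_of_smul_one_le (hVlow k) (x k - z₀)
    rw [← metricNorm_sq hα (hVlow k), inv_mul_le_iff₀ hμU] at h1
    have h2 : metricNorm (V k) (x k - z₀) ≤ M := hM ⟨k, rfl⟩
    have h3 : ‖x k - z₀‖ ≤ √(μU * M ^ 2) := by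
      refine Real.le_sqrt_of_sq_le (h1.trans ?_)
      have := metricNorm_nonneg (V k) (x k - z₀)
      gcongr
    have h4 := norm_add_le (x k - z₀) z₀
    rw [sub_add_cancel] at h4
    linarith
  -- The exact step is squeezed between the current distance and the next one corrected by metric
  -- change and error, so the surplus in `hdec` tends to zero.
  have hσlim : Tendsto (σ z₀) atTop (𝓝 ℓ) := by
    refine tendsto_of_tendsto_of_tendsto_of_le_of_le
      (g := fun k => metricNorm (V (k + 1)) (x (k + 1) - z₀) / (1 + η k) - D * t k) ?_ hℓ
      (fun k => ?_) (hσle z₀ hz₀)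
    · have h1 := ((tendsto_add_atTop_iff_nat 1).2 hℓ).div
        (hη_summable.tendsto_atTop_zero.const_add 1) (by norm_num)
      simpa using h1.sub (hts.tendsto_atTop_zero.const_mul D)
    · have := hη_nonneg k
      simp only [tsub_le_iff_right]
      rw [div_le_iff₀' (by linarith)]
      exact hnext z₀ k
  have hgap : Tendsto (fun k => metricNorm (V k) (x k - z₀) ^ 2 - σ z₀ k ^ 2) atTop (𝓝 0) := by
    simpa using (hℓ.pow 2).sub (hσlim.pow 2)
  have hnorm_zero : ∀ {u : ℕ → X} {c : ℝ}, 0 < c →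
      (∀ k, c * ‖u k‖ ^ 2 ≤ metricNorm (V k) (x k - z₀) ^ 2 - σ z₀ k ^ 2) →
      Tendsto u atTop (𝓝 0) := fun {u c} hc hu => by
    have h1 : Tendsto (fun k => ‖u k‖ ^ 2) atTop (𝓝 0) := by
      refine squeeze_zero (fun k => sq_nonneg _) (fun k => ?_) (by simpa using hgap.const_mul c⁻¹)
      rw [le_inv_mul_iff₀ hc]
      exact hu k
    rw [tendsto_zero_iff_norm_tendsto_zero]
    simpa [Real.sqrt_sq (norm_nonneg _)] using h1.sqrt
  have hxq : Tendsto (fun k => x k - q k) atTop (𝓝 0) := hnorm_zero hc₁0 fun k => by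
    have h1 := hdec z₀ hz₀ k
    have : 0 ≤ ε ^ 2 / 2 * ‖gradient f (x k) - gradient f z₀‖ ^ 2 := by positivity
    linarith
  have hgrad : Tendsto (fun k => gradient f (x k) - gradient f z₀) atTop (𝓝 0) :=
    hnorm_zero (c := ε ^ 2 / 2) (by positivity) fun k => by
      have h1 := hdec z₀ hz₀ k
      have : 0 ≤ c₁ * ‖x k - q k‖ ^ 2 := by positivity
      linarith
  refine exists_weaklyConvergesTo hα (inv_pos.2 hm0) hVlow hVupp hη_nonneg hη_summable hVstep hR
    (fun z hz => ?_) fun 𝒰 z h𝒰 hz => ?_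
  · obtain ⟨ℓ, hℓ⟩ := hlim z hz
    refine ⟨ℓ ^ 2, (hℓ.pow 2).congr fun k => metricNorm_sq hα (hVlow k) _⟩
  -- The gradients already converge strongly, to `∇f z₀`. Paired with `x k - z`, which tends weakly
  -- to zero, they make the right side of cocoercivity vanish in the limit.
  have hgz : Tendsto (fun k => gradient f (x k)) 𝒰 (𝓝 (gradient f z)) := by
    have h1 : Tendsto (fun k => gradient f (x k) - gradient f z) 𝒰
        (𝓝 (gradient f z₀ - gradient f z)) := by
      simpa using (hgrad.mono_left h𝒰).add_const (gradient f z₀ - gradient f z)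
    have h2 : Tendsto (fun k => ⟪x k - z, gradient f (x k) - gradient f z⟫_ℝ) 𝒰 (𝓝 0) := by
      have := tendsto_inner_of_weak (q := fun k => x k - z) (x := 0) (C := R + ‖z‖)
        (fun k => (norm_sub_le _ _).trans (add_le_add (hR k) le_rfl))
        (fun u => by simpa [inner_sub_left] using (hz u).sub_const ⟪z, u⟫_ℝ) h1
      simpa using this
    have h3 : Tendsto (fun k => ‖gradient f (x k) - gradient f z‖ ^ 2) 𝒰 (𝓝 0) := by
      refine squeeze_zero (fun k => sq_nonneg _) (fun k => ?_) (by simpa using h2.const_mul β⁻¹)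
      rw [le_inv_mul_iff₀ hβ, real_inner_comm]
      exact gradient_cocoercive hf_convex hf_diff hβ hf_lip (x k) z
    rw [tendsto_iff_norm_sub_tendsto_zero]
    simpa [Real.sqrt_sq (norm_nonneg _)] using h3.sqrt
  obtain ⟨M, hM⟩ := hxq.norm.bddAbove_range
  refine argmin_of_isSubgradient hg hf_convex hf_diff <|
    IsSubgradient.of_weak_tendsto hg (l := (𝒰 : Filter ℕ)) (C := R + M) (q := q)
      (fun k => isSubgradient_fbPoint hg hνU hμU (hU k).1 (hU k).2 (hγ0 k) (x k))
      (fun k => ?_) (fun u => ?_) ?_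
  · have h1 : ‖x k - q k‖ ≤ M := hM ⟨k, rfl⟩
    have h2 := norm_sub_le (x k) (x k - q k)
    rw [sub_sub_cancel] at h2
    linarith [hR k]
  · have h1 : Tendsto (fun k => ⟪x k - q k, u⟫_ℝ) 𝒰 (𝓝 ⟪(0 : X), u⟫_ℝ) :=
      Filter.Tendsto.inner (𝕜 := ℝ) (hxq.mono_left h𝒰) tendsto_const_nhds
    simpa [inner_sub_left] using (hz u).sub h1
  · have h1 : Tendsto (fun k => (γ k)⁻¹ • Ring.inverse (U k) (x k - q k)) 𝒰 (𝓝 0) := by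
      have h2 : Tendsto (fun k => ε⁻¹ * (νU⁻¹ * ‖x k - q k‖)) 𝒰 (𝓝 0) := by
        simpa using ((hxq.mono_left h𝒰).norm.const_mul νU⁻¹).const_mul ε⁻¹
      refine squeeze_zero_norm (fun k => ?_) h2
      rw [norm_smul, Real.norm_of_nonneg (inv_nonneg.2 (hγ0 k).le)]
      have h3 := (hγ k).1
      have h4 := (Ring.inverse (U k)).le_of_opNorm_le (norm_inverse_le hνU (hU k).1) (x k - q k)
      gcongr
    simpa using h1.sub hgz
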